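/- Let $M=\Gamma\backslash G$ be a $2n$-dimensional nilmanifold, i.e. the compact quotient of a simply connected nilpotent Lie group $G$ by a discrete subgroup $\Gamma$ acting by left multiplication. Let $\mathfrak g$ be the Lie algebra of $G$, and let $J$ be a complex structure on $\mathfrak g$: an endomorphism with $J^2=-\mathrm{Id}$ and $[JX,JY]=J[JX,Y]+J[X,JY]+[X,Y]$ for all $X,Y\in\mathfrak g$. Denote by $J$ also the induced invariant complex structure on $M$. Let $A^{p,q}(M)$ be the space of smooth complex-valued forms of type $(p,q)$ on $(M,J)$, and let $\Lambda^{p,q}(\mathfrak g^*)$ be the space of forms of type $(p,q)$ in $\Lambda^*\mathfrak g_{\mathbb C}^*$ (both are zero if $p<0$ or $q<0$). In both cases write $d=\partial+\bar\partial$ on forms of type $(p,q)$, with $\partial$ of type $(p+1,q)$ and $\bar\partial$ of type $(p,q+1)$, where $d$ is the exterior derivative on $M$, respectively the Chevalley–Eilenberg differential on $\mathfrak g$. Let $H^{p,q}(M,J)$ and $H^{p,q}(\mathfrak g,J)$ be the spaces of $\bar\partial$-closed forms of type $(p,q)$ modulo $\bar\partial$ of the forms of type $(p,q-1)$, for $A^{*,*}(M)$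 and $\Lambda^{*,*}(\mathfrak g^*)$ respectively. We say that $(M,J)$ (respectively $(\mathfrak g,J)$) satisfies the $(n-1,n)$-th weak $\partial\bar\partial$-lemma if for each real form $\varphi$ of type $(n-1,n-1)$ such that $\bar\partial\varphi=\partial\eta$ for some form $\eta$ of type $(n-2,n)$, there exists a form $\psi$ of type $(n-2,n-1)$ such that $\bar\partial\varphi=i\,\partial\bar\partial\psi$ (all forms taken in $A^{*,*}(M)$, respectively in $\Lambda^{*,*}(\mathfrak g^*)$). (a) If $(\mathfrak g,J)$ does not satisfy the $(n-1,n)$-th weak $\partial\bar\partial$-lemma, then $(M,J)$ does not satisfy the $(n-1,n)$-th weak $\partial\bar\partial$-lemma. (b) If $(\mathfrak g,J)$ satisfies the $(n-1,n)$-th weak $\partial\bar\partial$-lemma and the complex vector spaces $H^{n-2,n}(M,J)$ and $H^{n-2,n}(\mathfrak g,J)$ are isomorphic, then $(M,J)$ satisfies the $(n-1,n)$-th weak $\partial\bar\partial$-lemma. -/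

import Mathlib

noncomputable section

namespace WeakDdbar

/-! ### Forms of type `(p, q)` on a real vector space with an endomorphism `J`

A complex-valued `k`-form on a real vector space `V` (an element of the `k`-th exterior power of
the dual of the complexification of `V`) is an `ℝ`-multilinear alternating map with values in `ℂ`.
-/

section Pointwise

variable {V : Type*} [AddCommGroup V] [Module ℝ V]

/-- The exterior product `α₀ ∧ ⋯ ∧ αₖ₋₁` of complex-valued covectors,
`(α₀ ∧ ⋯ ∧ αₖ₋₁) (v₀, …, vₖ₋₁) = det (αⱼ (vᵢ))`. -/
def wedge {k : ℕ} (α : Fin k → V →ₗ[ℝ] ℂ) : V [⋀^Fin k]→ₗ[ℝ] ℂ :=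
  AlternatingMap.compLinearMap
    { (Matrix.detRowAlternating (n := Fin k) (R := ℂ)).toMultilinearMap.restrictScalars ℝ with
      map_eq_zero_of_eq' := fun v _ _ h hij =>
        (Matrix.detRowAlternating (n := Fin k) (R := ℂ)).map_eq_zero_of_eq v h hij }
    (LinearMap.pi α)

theorem wedge_apply {k : ℕ} (α : Fin k → V →ₗ[ℝ] ℂ) (v : Fin k → V) :
    wedge α v = Matrix.det (Matrix.of fun i j => α j (v i)) := rfl

/-- Covectors of type `(1, 0)`. -/
def IsOneZero (J : V →ₗ[ℝ] V) (α : V →ₗ[ℝ] ℂ) : Prop := ∀ v, α (J v) = Complex.I * α v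

/-- Covectors of type `(0, 1)`. -/
def IsZeroOne (J : V →ₗ[ℝ] V) (α : V →ₗ[ℝ] ℂ) : Prop := ∀ v, α (J v) = -Complex.I * α v

/-- The `k`-forms of type `(p, q)`: the complex span of the exterior products of `p` covectors of
type `(1, 0)` and `q` covectors of type `(0, 1)`. It is zero unless `0 ≤ p`, `0 ≤ q` and
`p + q = k`. -/
def typeSpace (J : V →ₗ[ℝ] V) (k : ℕ) (p q : ℤ) : Submodule ℂ (V [⋀^Fin k]→ₗ[ℝ] ℂ) :=
  Submodule.span ℂ {η | ∃ (S : Finset (Fin k)) (α : Fin k → V →ₗ[ℝ] ℂ),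
    (S.card : ℤ) = p ∧ (Sᶜ.card : ℤ) = q ∧
    (∀ i ∈ S, IsOneZero J (α i)) ∧ (∀ i ∉ S, IsZeroOne J (α i)) ∧ η = wedge α}

/-- The rotation `cos θ + sin θ J`. -/
def rot (J : V →ₗ[ℝ] V) (θ : ℝ) : V →ₗ[ℝ] V := Real.cos θ • LinearMap.id + Real.sin θ • J

/-- The sample angle `π j / (k + 1)`. -/
def angle (k j : ℕ) : ℝ := Real.pi * j / (k + 1)

/-- The coefficient `exp (-i (p - q) π j / (k + 1)) / (k + 1)`. -/
def fourierCoeff (k : ℕ) (p q : ℤ) (j : ℕ) : ℂ :=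
  ((k : ℂ) + 1)⁻¹ * Complex.exp (-(((p - q : ℤ) : ℂ) * (angle k j : ℂ) * Complex.I))

/-- The component of type `(p, q)` of a `k`-form (for `J ^ 2 = -1`): pulling back by
`cos θ + sin θ J` multiplies forms of type `(p, q)` by `exp (i (p - q) θ)`, and the finite Fourier
sum below extracts that weight. See `typeComponent_of_mem`, `typeComponent_of_mem_of_ne`
and `typeComponent_mem`. -/
def typeComponent (J : V →ₗ[ℝ] V) {k : ℕ} (p q : ℤ) (η : V [⋀^Fin k]→ₗ[ℝ] ℂ) :
    V [⋀^Fin k]→ₗ[ℝ] ℂ :=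
  if 0 ≤ p ∧ 0 ≤ q ∧ p + q = k then
    ∑ j ∈ Finset.range (k + 1), fourierCoeff k p q j • η.compLinearMap (rot J (angle k j))
  else 0

theorem typeComponent_add (J : V →ₗ[ℝ] V) {k : ℕ} (p q : ℤ) (η η' : V [⋀^Fin k]→ₗ[ℝ] ℂ) :
    typeComponent J p q (η + η') = typeComponent J p q η + typeComponent J p q η' := by
  unfold typeComponent
  split_ifs
  · rw [← Finset.sum_add_distrib]
    refine Finset.sum_congr rfl fun j _ => ?_
    rw [← smul_add]
    rfl
  · simp

theorem typeComponent_smul (J : V →ₗ[ℝ] V) {k : ℕ} (p q : ℤ) (c : ℂ) (η : V [⋀^Fin k]→ₗ[ℝ] ℂ) :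
    typeComponent J p q (c • η) = c • typeComponent J p q η := by
  unfold typeComponent
  split_ifs
  · rw [Finset.smul_sum]
    refine Finset.sum_congr rfl fun j _ => ?_
    rw [smul_comm c]
    rfl
  · simp

theorem IsOneZero.rot {J : V →ₗ[ℝ] V} {α : V →ₗ[ℝ] ℂ} (h : IsOneZero J α) (θ : ℝ) (v : V) :
    α (rot J θ v) = Complex.exp (θ * Complex.I) * α v := by
  simp only [WeakDdbar.rot, LinearMap.add_apply, LinearMap.smul_apply, LinearMap.id_apply, map_add,
    map_smul, h v, Complex.real_smul, Complex.exp_mul_I, Complex.ofReal_cos, Complex.ofReal_sin]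
  ring

theorem IsZeroOne.rot {J : V →ₗ[ℝ] V} {α : V →ₗ[ℝ] ℂ} (h : IsZeroOne J α) (θ : ℝ) (v : V) :
    α (rot J θ v) = Complex.exp (-(θ * Complex.I)) * α v := by
  rw [← neg_mul]
  simp only [WeakDdbar.rot, LinearMap.add_apply, LinearMap.smul_apply, LinearMap.id_apply, map_add,
    map_smul, h v, Complex.real_smul, Complex.exp_mul_I, Complex.ofReal_cos, Complex.ofReal_sin,
    Complex.cos_neg, Complex.sin_neg]
  ring

theorem compLinearMap_rot_of_mem {J : V →ₗ[ℝ] V} {k : ℕ} {p q : ℤ} {η : V [⋀^Fin k]→ₗ[ℝ] ℂ}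
    (h : η ∈ typeSpace J k p q) (θ : ℝ) :
    η.compLinearMap (rot J θ) = Complex.exp (((p - q : ℤ) : ℂ) * θ * Complex.I) • η := by
  induction h using Submodule.span_induction with
  | mem η h =>
    obtain ⟨S, α, hp, hq, h1, h2, rfl⟩ := h
    ext v
    have key : ∀ i, ∀ w, α i (rot J θ w) =
        (if i ∈ S then Complex.exp (θ * Complex.I) else Complex.exp (-(θ * Complex.I))) * α i w := by
      intro i w
      by_cases hi : i ∈ S
      · simp [hi, (h1 i hi).rot]
      · simp [hi, (h2 i hi).rot]
    simp only [AlternatingMap.compLinearMap_apply, AlternatingMap.smul_apply, wedge_apply, key,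
      smul_eq_mul]
    rw [show (Matrix.of fun i j => (if j ∈ S then Complex.exp (θ * Complex.I)
        else Complex.exp (-(θ * Complex.I))) * α j (v i)) =
        (Matrix.of fun i j => (if j ∈ S then Complex.exp (θ * Complex.I)
        else Complex.exp (-(θ * Complex.I))) * (Matrix.of fun i j => α j (v i)) i j) from rfl,
      Matrix.det_mul_row]
    congr 1
    rw [Finset.prod_ite]
    simp only [Finset.prod_const, ← Complex.exp_nat_mul, ← Complex.exp_add]
    have e1 : (Finset.univ.filter fun i => i ∈ S).card = S.card := by simp
    have e2 : (Finset.univ.filter fun i => i ∉ S).card = Sᶜ.card := by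
      congr 1; ext; simp
    rw [e1, e2, ← hp, ← hq]
    congr 1
    push_cast
    ring
  | zero => ext v; simp
  | add x y _ _ hx hy =>
    ext v
    have hx' := congrArg (fun f => f v) hx
    have hy' := congrArg (fun f => f v) hy
    simp only [AlternatingMap.compLinearMap_apply, AlternatingMap.smul_apply,
      AlternatingMap.add_apply, smul_eq_mul] at hx' hy' ⊢
    rw [hx', hy', mul_add]
  | smul c x _ hx =>
    ext v
    have hx' := congrArg (fun f => f v) hx
    simp only [AlternatingMap.compLinearMap_apply, AlternatingMap.smul_apply,
      smul_eq_mul] at hx' ⊢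
    rw [hx', mul_left_comm]

theorem typeSpace_eq_bot {J : V →ₗ[ℝ] V} {k : ℕ} {p q : ℤ}
    (h : ¬ (0 ≤ p ∧ 0 ≤ q ∧ p + q = k)) : typeSpace J k p q = ⊥ := by
  rw [typeSpace, Submodule.span_eq_bot]
  rintro η ⟨S, α, hp, hq, -⟩
  exfalso
  apply h
  have := S.card_add_card_compl
  rw [Fintype.card_fin] at this
  omega

theorem sum_fourier (k : ℕ) (m : ℤ) (hm : |m| ≤ k) :
    ∑ j ∈ Finset.range (k + 1), Complex.exp ((m : ℂ) * (2 * (angle k j : ℂ)) * Complex.I) =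
      if m = 0 then (k : ℂ) + 1 else 0 := by
  have hk : ((k : ℂ) + 1) ≠ 0 := by exact_mod_cast Nat.succ_ne_zero k
  split_ifs with h
  · simp [h]
  · have e : ∀ j : ℕ, Complex.exp ((m : ℂ) * (2 * (angle k j : ℂ)) * Complex.I) =
        Complex.exp (2 * Real.pi * Complex.I * (m / ((k : ℂ) + 1))) ^ j := by
      intro j
      rw [← Complex.exp_nat_mul]
      congr 1
      simp only [angle]
      push_cast
      field_simp
    simp only [e]
    have h1 : Complex.exp (2 * Real.pi * Complex.I * (m / ((k : ℂ) + 1))) ≠ 1 := by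
      rw [Ne, Complex.exp_eq_one_iff]
      rintro ⟨n, hn⟩
      have hpi : (2 * (Real.pi : ℂ) * Complex.I) ≠ 0 := Complex.two_pi_I_ne_zero
      have h2 : (m : ℂ) / ((k : ℂ) + 1) = n := by
        apply mul_left_cancel₀ hpi
        rw [hn]; ring
      rw [div_eq_iff hk] at h2
      have h3 : m = n * ((k : ℤ) + 1) := by exact_mod_cast h2
      rcases eq_or_ne n 0 with rfl | hn0
      · simp at h3; exact h h3
      · have h4 : (k : ℤ) + 1 ≤ |m| := by
          rw [h3, abs_mul, abs_of_nonneg (show (0 : ℤ) ≤ (k : ℤ) + 1 by positivity)]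
          have := Int.one_le_abs hn0
          nlinarith
        omega
    rw [geom_sum_eq h1, ← Complex.exp_nat_mul]
    rw [show (((k + 1 : ℕ) : ℂ) * (2 * Real.pi * Complex.I * (m / ((k : ℂ) + 1)))) =
      m * (2 * Real.pi * Complex.I) by push_cast; field_simp, Complex.exp_int_mul_two_pi_mul_I]
    simp

theorem sum_fourierCoeff_mul {k : ℕ} {p q p' q' : ℤ} (h : 0 ≤ p ∧ 0 ≤ q ∧ p + q = k)
    (h' : 0 ≤ p' ∧ 0 ≤ q' ∧ p' + q' = k) :
    ∑ j ∈ Finset.range (k + 1), fourierCoeff k p q j *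
      Complex.exp (((p' - q' : ℤ) : ℂ) * (angle k j : ℂ) * Complex.I) = if p' = p then 1 else 0 := by
  have hk : ((k : ℂ) + 1) ≠ 0 := by exact_mod_cast Nat.succ_ne_zero k
  have := sum_fourier k (p' - p) (by rw [abs_le]; omega)
  have e : ∀ j, fourierCoeff k p q j *
      Complex.exp (((p' - q' : ℤ) : ℂ) * (angle k j : ℂ) * Complex.I) = ((k : ℂ) + 1)⁻¹ *
      Complex.exp (((p' - p : ℤ) : ℂ) * (2 * (angle k j : ℂ)) * Complex.I) := by
    intro j
    rw [fourierCoeff, mul_assoc, ← Complex.exp_add]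
    congr 2
    have h1 : q = k - p := by omega
    have h2 : q' = k - p' := by omega
    subst h1 h2
    push_cast
    ring
  simp only [e]
  rw [← Finset.mul_sum, this]
  by_cases hp : p' = p
  · simp [hp, hk]
  · simp [hp, sub_ne_zero.2 hp]

theorem typeComponent_of_mem {J : V →ₗ[ℝ] V} {k : ℕ} {p q : ℤ} {η : V [⋀^Fin k]→ₗ[ℝ] ℂ}
    (h : η ∈ typeSpace J k p q) : typeComponent J p q η = η := by
  by_cases hpq : 0 ≤ p ∧ 0 ≤ q ∧ p + q = k
  · rw [typeComponent, if_pos hpq]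
    simp only [compLinearMap_rot_of_mem h, smul_smul]
    rw [← Finset.sum_smul, sum_fourierCoeff_mul hpq hpq, if_pos rfl, one_smul]
  · rw [typeSpace_eq_bot hpq, Submodule.mem_bot] at h
    simp [typeComponent, hpq, h]

theorem typeComponent_of_mem_of_ne {J : V →ₗ[ℝ] V} {k : ℕ} {p q p' q' : ℤ}
    {η : V [⋀^Fin k]→ₗ[ℝ] ℂ} (h : η ∈ typeSpace J k p' q') (hne : (p', q') ≠ (p, q)) :
    typeComponent J p q η = 0 := by
  by_cases hpq : 0 ≤ p ∧ 0 ≤ q ∧ p + q = k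
  · by_cases hpq' : 0 ≤ p' ∧ 0 ≤ q' ∧ p' + q' = k
    · rw [typeComponent, if_pos hpq]
      simp only [compLinearMap_rot_of_mem h, smul_smul]
      have : p' ≠ p := by
        rintro rfl
        exact hne (by rw [show q' = q by omega])
      rw [← Finset.sum_smul, sum_fourierCoeff_mul hpq hpq', if_neg this, zero_smul]
    · rw [typeSpace_eq_bot hpq', Submodule.mem_bot] at h
      subst h
      rw [typeComponent, if_pos hpq]
      refine Finset.sum_eq_zero fun j _ => ?_
      ext v
      simp
  · simp [typeComponent, hpq]

/-- The `(1, 0)` part of a covector. -/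
def oneZeroPart (J : V →ₗ[ℝ] V) (α : V →ₗ[ℝ] ℂ) : V →ₗ[ℝ] ℂ :=
  (1 / 2 : ℂ) • (α - Complex.I • (α ∘ₗ J))

/-- The `(0, 1)` part of a covector. -/
def zeroOnePart (J : V →ₗ[ℝ] V) (α : V →ₗ[ℝ] ℂ) : V →ₗ[ℝ] ℂ :=
  (1 / 2 : ℂ) • (α + Complex.I • (α ∘ₗ J))

theorem oneZeroPart_add_zeroOnePart (J : V →ₗ[ℝ] V) (α : V →ₗ[ℝ] ℂ) :
    oneZeroPart J α + zeroOnePart J α = α := by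
  ext v
  simp [oneZeroPart, zeroOnePart]
  ring

theorem isOneZero_oneZeroPart {J : V →ₗ[ℝ] V} (hJ : ∀ v, J (J v) = -v) (α : V →ₗ[ℝ] ℂ) :
    IsOneZero J (oneZeroPart J α) := by
  intro v
  simp [oneZeroPart, hJ]
  linear_combination (2⁻¹ * α (J v)) * Complex.I_mul_I

theorem isZeroOne_zeroOnePart {J : V →ₗ[ℝ] V} (hJ : ∀ v, J (J v) = -v) (α : V →ₗ[ℝ] ℂ) :
    IsZeroOne J (zeroOnePart J α) := by
  intro v
  simp [zeroOnePart, hJ]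
  linear_combination (2⁻¹ * α (J v)) * Complex.I_mul_I

theorem alternating_sum_apply {ι : Type*} {k : ℕ} (s : Finset ι) (f : ι → V [⋀^Fin k]→ₗ[ℝ] ℂ)
    (v : Fin k → V) : (∑ i ∈ s, f i) v = ∑ i ∈ s, f i v := by
  classical
  induction s using Finset.induction_on with
  | empty => simp
  | insert a s ha ih => simp [Finset.sum_insert ha, ih]

theorem wedge_add {k : ℕ} (β γ : Fin k → V →ₗ[ℝ] ℂ) :
    wedge (β + γ) = ∑ S : Finset (Fin k), wedge (S.piecewise β γ) := by
  ext v
  have h : ∀ α : Fin k → V →ₗ[ℝ] ℂ, wedge α v =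
      (Matrix.detRowAlternating (n := Fin k) (R := ℂ)) (fun j i => α j (v i)) := by
    intro α
    rw [wedge_apply, ← Matrix.det_transpose]
    rfl
  rw [alternating_sum_apply]
  simp only [h]
  have := (Matrix.detRowAlternating (n := Fin k) (R := ℂ)).toMultilinearMap.map_add_univ
    (fun j i => β j (v i)) (fun j i => γ j (v i))
  refine this.trans (Finset.sum_congr rfl fun S _ => ?_)
  refine congrArg (Matrix.detRowAlternating (n := Fin k) (R := ℂ)) ?_
  funext j i
  by_cases hj : j ∈ S <;> simp [hj]

theorem mem_span_wedge [FiniteDimensional ℝ V] {k : ℕ} (η : V [⋀^Fin k]→ₗ[ℝ] ℂ) :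
    η ∈ Submodule.span ℂ (Set.range (wedge (V := V) (k := k))) := by
  let b := Module.finBasis ℝ V
  let c : Fin (Module.finrank ℝ V) → V →ₗ[ℝ] ℂ := fun i => Complex.ofRealCLM.toLinearMap ∘ₗ b.coord i
  have key : (k.factorial : ℂ) • η =
      ∑ r : Fin k → Fin (Module.finrank ℝ V), η (b ∘ r) • wedge (fun j => c (r j)) := by
    ext v
    have exp : ∀ w : Fin k → V, η w = ∑ r : Fin k → Fin (Module.finrank ℝ V),
        η (b ∘ r) * ∏ i, c (r i) (w i) := by
      intro w
      conv_lhs => rw [show w = fun i => ∑ j, b.repr (w i) j • b j from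
        funext fun i => (b.sum_repr (w i)).symm]
      have h1 := η.toMultilinearMap.map_sum (fun i j => b.repr (w i) j • b j)
      refine h1.trans (Finset.sum_congr rfl fun r _ => ?_)
      have h2 := η.toMultilinearMap.map_smul_univ (fun i => b.repr (w i) (r i)) (fun i => b (r i))
      refine h2.trans ?_
      rw [Complex.real_smul, mul_comm]
      simp [c, Function.comp_def]
    simp only [AlternatingMap.smul_apply, alternating_sum_apply, wedge_apply, Matrix.det_apply',
      Matrix.of_apply, smul_eq_mul, Finset.mul_sum]
    rw [Finset.sum_comm]
    have h3 : ∀ σ : Equiv.Perm (Fin k), ∑ r : Fin k → Fin (Module.finrank ℝ V), η (b ∘ r) *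
        (((Equiv.Perm.sign σ : ℤ) : ℂ) * ∏ i, c (r i) (v (σ i))) = η v := by
      intro σ
      have h4 := exp (v ∘ σ)
      rw [AlternatingMap.map_perm] at h4
      have h5 : (((Equiv.Perm.sign σ : ℤ) : ℂ)) * (((Equiv.Perm.sign σ : ℤ) : ℂ)) = 1 := by
        rcases Int.units_eq_one_or (Equiv.Perm.sign σ) with h6 | h6 <;> simp [h6]
      have h7 : Equiv.Perm.sign σ • η v = ((Equiv.Perm.sign σ : ℤ) : ℂ) * η v := by
        rw [Units.smul_def, zsmul_eq_mul]
      rw [h7] at h4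
      calc _ = ((Equiv.Perm.sign σ : ℤ) : ℂ) * ∑ r : Fin k → Fin (Module.finrank ℝ V),
            η (b ∘ r) * ∏ i, c (r i) ((v ∘ σ) i) := by
            rw [Finset.mul_sum]
            refine Finset.sum_congr rfl fun r _ => ?_
            simp only [Function.comp_apply]
            ring
        _ = _ := by rw [← h4, ← mul_assoc, h5, one_mul]
    simp only [h3, Finset.sum_const, Finset.card_univ, Fintype.card_perm, Fintype.card_fin,
      nsmul_eq_mul]
  have hk : (k.factorial : ℂ) ≠ 0 := by exact_mod_cast k.factorial_ne_zero
  have : η = (k.factorial : ℂ)⁻¹ • ∑ r : Fin k → Fin (Module.finrank ℝ V),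
      η (b ∘ r) • wedge (fun j => c (r j)) := by
    rw [← key, smul_smul, inv_mul_cancel₀ hk, one_smul]
  rw [this]
  exact Submodule.smul_mem _ _ (Submodule.sum_mem _ fun r _ =>
    Submodule.smul_mem _ _ (Submodule.subset_span ⟨_, rfl⟩))

theorem typeComponent_mem [FiniteDimensional ℝ V] {J : V →ₗ[ℝ] V} (hJ : ∀ v, J (J v) = -v) {k : ℕ}
    (p q : ℤ) (η : V [⋀^Fin k]→ₗ[ℝ] ℂ) : typeComponent J p q η ∈ typeSpace J k p q := by
  have hwedge : ∀ (S : Finset (Fin k)) (α : Fin k → V →ₗ[ℝ] ℂ), (∀ i ∈ S, IsOneZero J (α i)) →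
      (∀ i ∉ S, IsZeroOne J (α i)) → typeComponent J p q (wedge α) ∈ typeSpace J k p q := by
    intro S α h1 h2
    have hm : wedge α ∈ typeSpace J k (S.card : ℤ) (Sᶜ.card : ℤ) :=
      Submodule.subset_span ⟨S, α, rfl, rfl, h1, h2, rfl⟩
    by_cases h : ((S.card : ℤ), (Sᶜ.card : ℤ)) = (p, q)
    · obtain ⟨rfl, rfl⟩ := Prod.mk.inj h
      rwa [typeComponent_of_mem hm]
    · rw [typeComponent_of_mem_of_ne hm h]
      exact Submodule.zero_mem _
  let T : (V [⋀^Fin k]→ₗ[ℝ] ℂ) →ₗ[ℂ] (V [⋀^Fin k]→ₗ[ℝ] ℂ) :=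
    { toFun := typeComponent J p q, map_add' := typeComponent_add J p q,
      map_smul' := typeComponent_smul J p q }
  have hle : Submodule.span ℂ (Set.range (wedge (V := V) (k := k))) ≤
      (typeSpace J k p q).comap T := by
    rw [Submodule.span_le]
    rintro _ ⟨α, rfl⟩
    have e : α = (fun i => oneZeroPart J (α i)) + (fun i => zeroOnePart J (α i)) :=
      funext fun i => (oneZeroPart_add_zeroOnePart J (α i)).symm
    rw [e, wedge_add]
    refine Submodule.sum_mem _ fun S _ => ?_
    refine hwedge S _ (fun i hi => ?_) (fun i hi => ?_)
    · rw [Finset.piecewise_eq_of_mem _ _ _ hi]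
      exact isOneZero_oneZeroPart hJ _
    · rw [Finset.piecewise_eq_of_notMem _ _ _ hi]
      exact isZeroOne_zeroOnePart hJ _
  exact hle (mem_span_wedge η)

end Pointwise

/-! ### The complex of a Lie algebra with a complex structure

A form on a Lie algebra is a family `η k`, `k = 0, 1, 2, …`, of homogeneous components. -/

section LieAlgebra

variable {𝔤 : Type*} [LieRing 𝔤] [LieAlgebra ℝ 𝔤]

/-- Complex structures on a real Lie algebra: `J ^ 2 = -1` and
`[J X, J Y] = J [J X, Y] + J [X, J Y] + [X, Y]`. -/
structure IsComplexStructure (J : 𝔤 →ₗ[ℝ] 𝔤) : Prop where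
  sq : ∀ X, J (J X) = -X
  nijenhuis : ∀ X Y, ⁅J X, J Y⁆ = J ⁅J X, Y⁆ + J ⁅X, J Y⁆ + ⁅X, Y⁆

/-- The Chevalley–Eilenberg differential of a form of positive degree, with trivial coefficients;
see `ceDiff_apply` for the usual formula. -/
def ceDiff {m : ℕ} (η : 𝔤 [⋀^Fin (m + 1)]→ₗ[ℝ] ℂ) : 𝔤 [⋀^Fin (m + 2)]→ₗ[ℝ] ℂ :=
  (-(1 / 2) : ℂ) • AlternatingMap.alternatizeUncurryFin (AlternatingMap.alternatizeUncurryFinLM ∘ₗ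
    (LieModule.toEnd ℝ 𝔤 𝔤 : 𝔤 →ₗ[ℝ] 𝔤 →ₗ[ℝ] 𝔤).compr₂ η.curryLeft)

/-- `dη (X₀, …, Xₘ₊₁) = ∑_{a < b} (-1) ^ (a + b) η ([X_a, X_b], X₀, …, X̂_a, …, X̂_b, …, Xₘ₊₁)`,
where the pairs `a < b` are written `a = i`, `b = j + 1` with `i ≤ j`. -/
theorem ceDiff_apply {m : ℕ} (η : 𝔤 [⋀^Fin (m + 1)]→ₗ[ℝ] ℂ) (X : Fin (m + 2) → 𝔤) :
    ceDiff η X = ∑ i : Fin (m + 1), ∑ j ≥ i, (-1 : ℂ) ^ ((i : ℕ) + ((j : ℕ) + 1)) *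
      η (Matrix.vecCons ⁅X i.castSucc, X j.succ⁆ (j.removeNth <| i.castSucc.removeNth X)) := by
  rw [ceDiff, AlternatingMap.smul_apply,
    AlternatingMap.alternatizeUncurryFin_alternatizeUncurryFinLM_comp_apply, Finset.smul_sum]
  refine Finset.sum_congr rfl fun i _ => ?_
  rw [Finset.smul_sum]
  refine Finset.sum_congr rfl fun j _ => ?_
  have h1 : ((LieModule.toEnd ℝ 𝔤 𝔤 : 𝔤 →ₗ[ℝ] 𝔤 →ₗ[ℝ] 𝔤).compr₂ η.curryLeft) (X j.succ)
      (X i.castSucc) = - ((LieModule.toEnd ℝ 𝔤 𝔤 : 𝔤 →ₗ[ℝ] 𝔤 →ₗ[ℝ] 𝔤).compr₂ η.curryLeft)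
      (X i.castSucc) (X j.succ) := by
    simp only [LinearMap.compr₂_apply, LieHom.coe_toLinearMap, LieModule.toEnd_apply_apply]
    rw [← lie_skew, map_neg]
  rw [h1]
  simp only [AlternatingMap.neg_apply, LinearMap.compr₂_apply, LieHom.coe_toLinearMap,
    LieModule.toEnd_apply_apply, AlternatingMap.curryLeft_apply_apply, zsmul_eq_mul, smul_eq_mul]
  push_cast
  ring

variable (𝔤) in
/-- The complexified exterior algebra of the dual of `𝔤`. -/
abbrev LieForm : Type _ := (k : ℕ) → 𝔤 [⋀^Fin k]→ₗ[ℝ] ℂ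

/-- The Chevalley–Eilenberg differential (zero on constants). -/
def ceD (η : LieForm 𝔤) : LieForm 𝔤
  | 0 => 0
  | 1 => 0
  | m + 2 => ceDiff (η (m + 1))

theorem ceDiff_add {m : ℕ} (η η' : 𝔤 [⋀^Fin (m + 1)]→ₗ[ℝ] ℂ) :
    ceDiff (η + η') = ceDiff η + ceDiff η' := by
  ext X
  simp [ceDiff_apply, mul_add, Finset.sum_add_distrib]

theorem ceDiff_smul {m : ℕ} (c : ℂ) (η : 𝔤 [⋀^Fin (m + 1)]→ₗ[ℝ] ℂ) :
    ceDiff (c • η) = c • ceDiff η := by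
  ext X
  simp [ceDiff_apply, Finset.mul_sum, mul_left_comm]

theorem ceD_add (η η' : LieForm 𝔤) : ceD (η + η') = ceD η + ceD η' := by
  funext k
  match k with
  | 0 => simp [ceD]
  | 1 => simp [ceD]
  | m + 2 => exact ceDiff_add _ _

theorem ceD_smul (c : ℂ) (η : LieForm 𝔤) : ceD (c • η) = c • ceD η := by
  funext k
  match k with
  | 0 => simp [ceD]
  | 1 => simp [ceD]
  | m + 2 => exact ceDiff_smul _ _

variable (J : 𝔤 →ₗ[ℝ] 𝔤)

/-- The forms of type `(p, q)` on `(𝔤, J)`. -/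
def lieA (p q : ℤ) : Submodule ℂ (LieForm 𝔤) where
  carrier := {η | ∀ k, η k ∈ typeSpace J k p q}
  add_mem' := fun h h' k => Submodule.add_mem _ (h k) (h' k)
  zero_mem' := fun _ => Submodule.zero_mem _
  smul_mem' := fun c _ h k => Submodule.smul_mem _ c (h k)

/-- `∂` on forms of type `(p, q)`: the component of type `(p + 1, q)` of the differential. -/
def lieDel (p q : ℤ) (η : LieForm 𝔤) : LieForm 𝔤 := fun k => typeComponent J (p + 1) q (ceD η k)

/-- `∂̄` on forms of type `(p, q)`: the component of type `(p, q + 1)` of the differential. -/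
def lieDelbar (p q : ℤ) (η : LieForm 𝔤) : LieForm 𝔤 := fun k => typeComponent J p (q + 1) (ceD η k)

/-- `(𝔤, J)` satisfies the `(n - 1, n)`-th weak `∂∂̄`-lemma: for each real form `φ` of type
`(n - 1, n - 1)` such that `∂̄φ = ∂η` for some `η` of type `(n - 2, n)`, there is `ψ` of type
`(n - 2, n - 1)` with `∂̄φ = i ∂∂̄ψ`. -/
def LieWeakDdbar (n : ℤ) : Prop :=
  ∀ φ ∈ lieA J (n - 1) (n - 1), (∀ k X, (φ k X).im = 0) →
    (∃ η ∈ lieA J (n - 2) n, lieDelbar J (n - 1) (n - 1) φ = lieDel J (n - 2) n η) →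
    ∃ ψ ∈ lieA J (n - 2) (n - 1), lieDelbar J (n - 1) (n - 1) φ =
      Complex.I • lieDel J (n - 2) n (lieDelbar J (n - 2) (n - 1) ψ)

/-- `∂̄` as a linear map on the forms of type `(p, q)`. -/
def lieDelbarLin (p q : ℤ) : lieA J p q →ₗ[ℂ] LieForm 𝔤 where
  toFun η := lieDelbar J p q η
  map_add' η η' := by
    funext k
    simp [lieDelbar, ceD_add, typeComponent_add]
  map_smul' c η := by
    funext k
    simp [lieDelbar, ceD_smul, typeComponent_smul]

/-- The `∂̄`-closed forms of type `(p, q)` on `(𝔤, J)`. -/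
def lieZ (p q : ℤ) : Submodule ℂ (LieForm 𝔤) :=
  (LinearMap.ker (lieDelbarLin J p q)).map (lieA J p q).subtype

/-- The cohomology `H^{p,q}(𝔤, J)` of the complex of forms of type `(p, •)` with `∂̄`: the
`∂̄`-closed forms of type `(p, q)` modulo the `∂̄`-images of the forms of type `(p, q - 1)`. -/
abbrev LieDolbeault (p q : ℤ) : Type _ :=
  ↥(lieZ J p q) ⧸ (LinearMap.range (lieDelbarLin J p (q - 1))).submoduleOf (lieZ J p q)

end LieAlgebra

/-! ### Complex-valued differential forms on a manifold with an endomorphism field `J` -/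

section Manifold

open scoped Manifold ContDiff

variable {E : Type*} [NormedAddCommGroup E] [NormedSpace ℝ E]
  {M : Type*} [TopologicalSpace M] [ChartedSpace E M]

/-- The expression of a differential form in the chart around `x₀`. -/
def inChart {k : ℕ} (x₀ : M) (η : (x : M) → TangentSpace 𝓘(ℝ, E) x [⋀^Fin k]→L[ℝ] ℂ) (y : E) :
    E [⋀^Fin k]→L[ℝ] ℂ :=
  (η ((extChartAt 𝓘(ℝ, E) x₀).symm y)).compContinuousLinearMap
    (mfderiv 𝓘(ℝ, E) 𝓘(ℝ, E) (extChartAt 𝓘(ℝ, E) x₀).symm y)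

/-- Smoothness of a differential form: its expression in each chart is smooth. -/
def IsSmoothForm {k : ℕ} (η : (x : M) → TangentSpace 𝓘(ℝ, E) x [⋀^Fin k]→L[ℝ] ℂ) : Prop :=
  ∀ x₀ : M, ContDiffOn ℝ ∞ (inChart x₀ η) (extChartAt 𝓘(ℝ, E) x₀).target

/-- The exterior derivative of a differential form, computed at `x` in the chart around `x`. -/
def extD {k : ℕ} (η : (x : M) → TangentSpace 𝓘(ℝ, E) x [⋀^Fin k]→L[ℝ] ℂ) (x : M) :
    TangentSpace 𝓘(ℝ, E) x [⋀^Fin (k + 1)]→L[ℝ] ℂ :=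
  (extDeriv (inChart x η) (extChartAt 𝓘(ℝ, E) x x)).compContinuousLinearMap
    (mfderiv 𝓘(ℝ, E) 𝓘(ℝ, E) (extChartAt 𝓘(ℝ, E) x) x)

variable (E M) in
/-- Families of (not necessarily smooth) complex-valued forms, one in each degree. -/
def MForm : Type _ := (k : ℕ) → (x : M) → TangentSpace 𝓘(ℝ, E) x [⋀^Fin k]→L[ℝ] ℂ

instance : AddCommGroup (MForm E M) :=
  inferInstanceAs (AddCommGroup ((k : ℕ) → (x : M) → TangentSpace 𝓘(ℝ, E) x [⋀^Fin k]→L[ℝ] ℂ))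

instance : Module ℂ (MForm E M) :=
  inferInstanceAs (Module ℂ ((k : ℕ) → (x : M) → TangentSpace 𝓘(ℝ, E) x [⋀^Fin k]→L[ℝ] ℂ))

theorem inChart_add {k : ℕ} (x₀ : M)
    (η η' : (x : M) → TangentSpace 𝓘(ℝ, E) x [⋀^Fin k]→L[ℝ] ℂ) :
    inChart x₀ (η + η') = inChart x₀ η + inChart x₀ η' := rfl

theorem inChart_smul {k : ℕ} (x₀ : M) (c : ℂ)
    (η : (x : M) → TangentSpace 𝓘(ℝ, E) x [⋀^Fin k]→L[ℝ] ℂ) :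
    inChart x₀ (c • η) = c • inChart x₀ η := rfl

theorem IsSmoothForm.zero {k : ℕ} :
    IsSmoothForm (0 : (x : M) → TangentSpace 𝓘(ℝ, E) x [⋀^Fin k]→L[ℝ] ℂ) := fun _ =>
  (contDiffOn_const (c := (0 : E [⋀^Fin k]→L[ℝ] ℂ))).congr fun _ _ => rfl

theorem IsSmoothForm.add {k : ℕ} {η η' : (x : M) → TangentSpace 𝓘(ℝ, E) x [⋀^Fin k]→L[ℝ] ℂ}
    (h : IsSmoothForm η) (h' : IsSmoothForm η') : IsSmoothForm (η + η') := fun x₀ =>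
  (h x₀).add (h' x₀)

theorem IsSmoothForm.smul {k : ℕ} {η : (x : M) → TangentSpace 𝓘(ℝ, E) x [⋀^Fin k]→L[ℝ] ℂ}
    (c : ℂ) (h : IsSmoothForm η) : IsSmoothForm (c • η) := fun x₀ =>
  (h x₀).const_smul c

theorem IsSmoothForm.differentiableAt {k : ℕ}
    {η : (x : M) → TangentSpace 𝓘(ℝ, E) x [⋀^Fin k]→L[ℝ] ℂ} (h : IsSmoothForm η) (x : M) :
    DifferentiableAt ℝ (inChart x η) (extChartAt 𝓘(ℝ, E) x x) :=
  ((h x).contDiffAt (extChartAt_target_mem_nhds x)).differentiableAt (by simp)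

theorem extD_add {k : ℕ} {η η' : (x : M) → TangentSpace 𝓘(ℝ, E) x [⋀^Fin k]→L[ℝ] ℂ}
    (h : IsSmoothForm η) (h' : IsSmoothForm η') : extD (η + η') = extD η + extD η' := by
  funext x
  have := extDeriv_add (h.differentiableAt x) (h'.differentiableAt x)
  unfold extD
  rw [inChart_add, this]
  rfl

theorem extD_smul {k : ℕ} (c : ℂ) {η : (x : M) → TangentSpace 𝓘(ℝ, E) x [⋀^Fin k]→L[ℝ] ℂ}
    (h : IsSmoothForm η) : extD (c • η) = c • extD η := by
  funext x
  have : extDeriv (c • inChart x η) (extChartAt 𝓘(ℝ, E) x x) =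
      c • extDeriv (inChart x η) (extChartAt 𝓘(ℝ, E) x x) := by
    unfold extDeriv
    rw [fderiv_const_smul (h.differentiableAt x)]
    ext v
    simp [ContinuousAlternatingMap.alternatizeUncurryFin_apply, Finset.mul_sum]
  unfold extD
  rw [inChart_smul, this]
  rfl

variable (J : (x : M) → TangentSpace 𝓘(ℝ, E) x →L[ℝ] TangentSpace 𝓘(ℝ, E) x)

/-- The component of type `(p, q)` of a form, at each point. -/
def typePart (p q : ℤ) {k : ℕ} (η : (x : M) → TangentSpace 𝓘(ℝ, E) x [⋀^Fin k]→L[ℝ] ℂ) (x : M) :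
    TangentSpace 𝓘(ℝ, E) x [⋀^Fin k]→L[ℝ] ℂ :=
  if 0 ≤ p ∧ 0 ≤ q ∧ p + q = k then
    ∑ j ∈ Finset.range (k + 1), fourierCoeff k p q j • (η x).compContinuousLinearMap
      (Real.cos (angle k j) • ContinuousLinearMap.id ℝ (TangentSpace 𝓘(ℝ, E) x) +
        Real.sin (angle k j) • J x)
  else 0

theorem typePart_toAlternatingMap (p q : ℤ) {k : ℕ}
    (η : (x : M) → TangentSpace 𝓘(ℝ, E) x [⋀^Fin k]→L[ℝ] ℂ) (x : M) :
    (typePart J p q η x).toAlternatingMap =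
      typeComponent (J x).toLinearMap p q (η x).toAlternatingMap := by
  unfold typePart typeComponent
  split_ifs
  · ext v
    simp [alternating_sum_apply, rot, Function.comp_def]
  · rfl

theorem typePart_apply (p q : ℤ) {k : ℕ}
    (η : (x : M) → TangentSpace 𝓘(ℝ, E) x [⋀^Fin k]→L[ℝ] ℂ) (x : M)
    (v : Fin k → TangentSpace 𝓘(ℝ, E) x) :
    typePart J p q η x v = typeComponent (J x).toLinearMap p q (η x).toAlternatingMap v :=
  congrArg (fun f => f v) (typePart_toAlternatingMap J p q η x)

theorem typePart_add (p q : ℤ) {k : ℕ}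
    (η η' : (x : M) → TangentSpace 𝓘(ℝ, E) x [⋀^Fin k]→L[ℝ] ℂ) (x : M) :
    typePart J p q (η + η') x = typePart J p q η x + typePart J p q η' x := by
  refine ContinuousAlternatingMap.ext fun v => ?_
  rw [ContinuousAlternatingMap.add_apply, typePart_apply, typePart_apply, typePart_apply,
    ← AlternatingMap.add_apply, ← typeComponent_add]
  rfl

theorem typePart_smul (p q : ℤ) {k : ℕ} (c : ℂ)
    (η : (x : M) → TangentSpace 𝓘(ℝ, E) x [⋀^Fin k]→L[ℝ] ℂ) (x : M) :
    typePart J p q (c • η) x = c • typePart J p q η x := by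
  refine ContinuousAlternatingMap.ext fun v => ?_
  rw [ContinuousAlternatingMap.smul_apply, typePart_apply, typePart_apply,
    ← AlternatingMap.smul_apply, ← typeComponent_smul]
  rfl

/-- The exterior derivative, in all degrees. -/
def mD (η : MForm E M) : MForm E M
  | 0 => 0
  | k + 1 => extD (η k)

theorem mD_add {η η' : MForm E M} (h : ∀ k, IsSmoothForm (η k)) (h' : ∀ k, IsSmoothForm (η' k)) :
    mD (η + η') = mD η + mD η' := by
  funext k
  match k with
  | 0 => exact (add_zero (0 : (x : M) → TangentSpace 𝓘(ℝ, E) x [⋀^Fin 0]→L[ℝ] ℂ)).symm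
  | k + 1 => exact extD_add (h k) (h' k)

theorem mD_smul (c : ℂ) {η : MForm E M} (h : ∀ k, IsSmoothForm (η k)) :
    mD (c • η) = c • mD η := by
  funext k
  match k with
  | 0 => exact (smul_zero (A := (x : M) → TangentSpace 𝓘(ℝ, E) x [⋀^Fin 0]→L[ℝ] ℂ) c).symm
  | k + 1 => exact extD_smul c (h k)

/-- The smooth forms of type `(p, q)` on `(M, J)`. -/
def mA (p q : ℤ) : Submodule ℂ (MForm E M) where
  carrier := {η | ∀ k, IsSmoothForm (η k) ∧
    ∀ x, (η k x).toAlternatingMap ∈ typeSpace (J x).toLinearMap k p q}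
  add_mem' := fun h h' k => ⟨(h k).1.add (h' k).1,
    fun x => Submodule.add_mem _ ((h k).2 x) ((h' k).2 x)⟩
  zero_mem' := fun _ => ⟨IsSmoothForm.zero, fun _ => Submodule.zero_mem _⟩
  smul_mem' := fun c _ h k => ⟨(h k).1.smul c, fun x => Submodule.smul_mem _ c ((h k).2 x)⟩

/-- `∂` on forms of type `(p, q)`: the component of type `(p + 1, q)` of the differential. -/
def mDel (p q : ℤ) (η : MForm E M) : MForm E M := fun k => typePart J (p + 1) q (mD η k)

/-- `∂̄` on forms of type `(p, q)`: the component of type `(p, q + 1)` of the differential. -/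
def mDelbar (p q : ℤ) (η : MForm E M) : MForm E M := fun k => typePart J p (q + 1) (mD η k)

/-- `(M, J)`, of complex dimension `n`, satisfies the `(n - 1, n)`-th weak `∂∂̄`-lemma: for each
real form `φ` of type `(n - 1, n - 1)` such that `∂̄φ = ∂η` for some `η` of type `(n - 2, n)`,
there is `ψ` of type `(n - 2, n - 1)` with `∂̄φ = i ∂∂̄ψ`. -/
def MWeakDdbar (n : ℤ) : Prop :=
  ∀ φ ∈ mA J (n - 1) (n - 1), (∀ k x X, (φ k x X).im = 0) →
    (∃ η ∈ mA J (n - 2) n, mDelbar J (n - 1) (n - 1) φ = mDel J (n - 2) n η) →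
    ∃ ψ ∈ mA J (n - 2) (n - 1), mDelbar J (n - 1) (n - 1) φ =
      Complex.I • mDel J (n - 2) n (mDelbar J (n - 2) (n - 1) ψ)

/-- `∂̄` as a linear map on the smooth forms of type `(p, q)`. -/
def mDelbarLin (p q : ℤ) : mA J p q →ₗ[ℂ] MForm E M where
  toFun η := mDelbar J p q η
  map_add' η η' := by
    have h : mD ((η : MForm E M) + (η' : MForm E M)) = mD (η : MForm E M) + mD (η' : MForm E M) :=
      mD_add (fun k => (η.2 k).1) (fun k => (η'.2 k).1)
    funext k x
    exact (congrArg (fun ζ : MForm E M => typePart J p (q + 1) (ζ k) x) h).trans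
      (typePart_add J p (q + 1) _ _ x)
  map_smul' c η := by
    have h : mD (c • (η : MForm E M)) = c • mD (η : MForm E M) :=
      mD_smul c (fun k => (η.2 k).1)
    funext k x
    exact (congrArg (fun ζ : MForm E M => typePart J p (q + 1) (ζ k) x) h).trans
      (typePart_smul J p (q + 1) c _ x)

/-- The `∂̄`-closed smooth forms of type `(p, q)` on `(M, J)`. -/
def mZ (p q : ℤ) : Submodule ℂ (MForm E M) :=
  (LinearMap.ker (mDelbarLin J p q)).map (mA J p q).subtype

/-- The Dolbeault cohomology `H^{p,q}(M, J)`: the `∂̄`-closed smooth forms of type `(p, q)` modulo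
the `∂̄`-images of the smooth forms of type `(p, q - 1)`. -/
abbrev Dolbeault (p q : ℤ) : Type _ :=
  ↥(mZ J p q) ⧸ (LinearMap.range (mDelbarLin J p (q - 1))).submoduleOf (mZ J p q)

end Manifold

/-! ### Nilmanifolds and invariant complex structures -/

section Nilmanifold

open scoped Manifold ContDiff

variable {E : Type*} [NormedAddCommGroup E] [NormedSpace ℝ E]
  {G : Type*} [TopologicalSpace G] [ChartedSpace E G] [Group G]
  {M : Type*} [TopologicalSpace M] [ChartedSpace E M]

/-- A smooth real Lie group has the (finite) smoothness required for its Lie algebra structure. -/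
instance instLEInftyMinSmoothness : ENat.LEInfty (minSmoothness ℝ 3) :=
  ⟨by rw [minSmoothness_of_isRCLikeNormedField]; exact ENat.LEInfty.out⟩

variable (E) in
/-- `π : G → M` exhibits the manifold `M` as the quotient manifold `Γ \ G` of the Lie group `G` by
left multiplication by the elements of the subgroup `Γ`: it is a surjective local diffeomorphism
whose fibres are the cosets `Γ g`. -/
structure IsQuotientManifold (Γ : Subgroup G) (π : G → M) : Prop where
  isLocalDiffeomorph : IsLocalDiffeomorph 𝓘(ℝ, E) 𝓘(ℝ, E) ∞ π
  surjective : Function.Surjective π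
  eq_iff : ∀ g h : G, π g = π h ↔ ∃ γ ∈ Γ, γ * g = h

/-- The endomorphism field `JM` on `M = Γ \ G` is the invariant one that stems from the
endomorphism `J` of the Lie algebra of `G`: at `π g` it sends the projection of the left-invariant
field `X` to the projection of the left-invariant field `J X`. -/
def IsInvariantField (π : G → M) (J : GroupLieAlgebra 𝓘(ℝ, E) G →ₗ[ℝ] GroupLieAlgebra 𝓘(ℝ, E) G)
    (JM : (x : M) → TangentSpace 𝓘(ℝ, E) x →L[ℝ] TangentSpace 𝓘(ℝ, E) x) : Prop :=
  ∀ (g : G) (X : GroupLieAlgebra 𝓘(ℝ, E) G),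
    JM (π g) (mfderiv 𝓘(ℝ, E) 𝓘(ℝ, E) π g (mulInvariantVectorField X g)) =
      mfderiv 𝓘(ℝ, E) 𝓘(ℝ, E) π g (mulInvariantVectorField (J X) g)

end Nilmanifold

end WeakDdbar

/-! The proof is by symmetrisation. Read in the left-invariant frame, a form on M = Γ\G becomes a
function on G, constant on the fibres of π, with values in the forms on the Lie algebra (`coefLie`).
Forms on the Lie algebra are the constant functions among these (`incl`), and a linear functional Φ
on functions averages an arbitrary form to one on the Lie algebra (`avg`).

The functional comes from amenability: a nilpotent group has a right-invariant mean on bounded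
continuous functions (`exists_invariant_mean`), and continuous functions pulled back from the
compact M are bounded. Left-invariant fields are the infinitesimal right translations, so the mean
kills derivatives along them (`mean_derivative_eq_zero`). In the formula for dη on the frame
(`coef_extD_succ`) only the bracket terms survive the mean, and these form the Chevalley–Eilenberg
differential; thus `avg` commutes with d (`avg_mD`). As J is invariant, `avg` and `incl` also
respect types, hence commute with ∂ and ∂̄, and `avg` after `incl` is the identity (`avg_incl`).

For (a), contrapositively, invariant data are solved on M and the solution ψ is averaged. For (b),
let ∂̄φ = ∂η on M and ζ = η - incl (avg η). It is ∂̄-closed because there are no forms of type (n-2,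
n+1). Averaging maps H^{n-2,n}(M) onto the finite-dimensional H^{n-2,n} of the Lie algebra; as the
two are isomorphic, this surjection is injective, and avg ζ = 0 gives ζ = ∂̄ψ₁
(`exists_mDelbar_eq`). If ψ₀ solves the averaged problem on the Lie algebra, then incl ψ₀ - iψ₁
solves the one on M. -/

namespace WeakDdbar

/-! ### Invariant means on nilpotent groups -/

section InvariantMean

open Filter Topology BoundedContinuousFunction
open scoped commutatorElement

variable {G : Type*} [TopologicalSpace G] [Group G] [ContinuousMul G]

/-- Right translation of a bounded continuous function. -/
def rightTranslate (g : G) (f : G →ᵇ ℝ) : G →ᵇ ℝ :=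
  f.compContinuous ⟨(· * g), continuous_mul_const g⟩

theorem rightTranslate_apply (g x : G) (f : G →ᵇ ℝ) : rightTranslate g f x = f (x * g) := rfl

theorem rightTranslate_mul (g h : G) (f : G →ᵇ ℝ) :
    rightTranslate (g * h) f = rightTranslate g (rightTranslate h f) := by
  ext x
  simp [rightTranslate_apply, mul_assoc]

theorem norm_rightTranslate_le (g : G) (f : G →ᵇ ℝ) : ‖rightTranslate g f‖ ≤ ‖f‖ :=
  (norm_le (norm_nonneg f)).2 fun x => f.norm_coe_le_norm (x * g)

variable (G) in
/-- The means on the bounded continuous functions. -/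
def means : Set (WeakDual ℝ (G →ᵇ ℝ)) := {φ | (∀ f, |φ f| ≤ ‖f‖) ∧ φ 1 = 1}

-- Banach–Alaoglu: the means are a weak-* closed part of the dual unit ball.
omit [Group G] [ContinuousMul G] in
theorem isCompact_means : IsCompact (means G) := by
  have hsub : means G ⊆ WeakDual.toStrongDual ⁻¹' Metric.closedBall 0 1 := by
    intro φ hφ
    simp only [Set.mem_preimage]
    exact ContinuousLinearMap.opNorm_le_bound _ zero_le_one fun f => by
      simpa using hφ.1 f
  refine (WeakDual.isCompact_closedBall (𝕜 := ℝ) (0 : StrongDual ℝ (G →ᵇ ℝ)) 1).of_isClosed_subset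
    ?_ hsub
  have : means G = (⋂ f, {φ : WeakDual ℝ (G →ᵇ ℝ) | |φ f| ≤ ‖f‖}) ∩ {φ | φ 1 = 1} := by
    ext φ
    simp [means]
  rw [this]
  exact (isClosed_iInter fun f =>
    isClosed_le (WeakDual.eval_continuous f).abs continuous_const).inter
    (isClosed_eq (WeakDual.eval_continuous _) continuous_const)

/-- The means that are invariant under the right translations by the elements of `T`. -/
def invariantMeans (T : Set G) : Set (WeakDual ℝ (G →ᵇ ℝ)) :=
  {φ ∈ means G | ∀ t ∈ T, ∀ f, φ (rightTranslate t f) = φ f}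

theorem isClosed_setOf_invariant (T : Set G) :
    IsClosed {φ : WeakDual ℝ (G →ᵇ ℝ) | ∀ t ∈ T, ∀ f, φ (rightTranslate t f) = φ f} := by
  simp only [Set.ofPred_forall]
  exact isClosed_iInter fun t => isClosed_iInter fun _ => isClosed_iInter fun f =>
    isClosed_eq (WeakDual.eval_continuous _) (WeakDual.eval_continuous _)

theorem isCompact_invariantMeans (T : Set G) : IsCompact (invariantMeans T) :=
  isCompact_means.inter_right (isClosed_setOf_invariant T)

/-- Right translation as a continuous linear map. -/
def rightTranslateCLM (g : G) : (G →ᵇ ℝ) →L[ℝ] (G →ᵇ ℝ) :=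
  LinearMap.mkContinuous (IsLinearMap.mk' (rightTranslate g) ⟨fun _ _ => rfl, fun _ _ => rfl⟩) 1
    fun f => (norm_rightTranslate_le g f).trans_eq (one_mul _).symm

/-- The average of `φ` over the first `n + 1` powers of `a`. -/
def cesaro (a : G) (φ : WeakDual ℝ (G →ᵇ ℝ)) (n : ℕ) : WeakDual ℝ (G →ᵇ ℝ) :=
  WeakDual.toStrongDual.symm ((n + 1 : ℝ)⁻¹ • ∑ i ∈ Finset.range (n + 1),
    (WeakDual.toStrongDual φ).comp (rightTranslateCLM (a ^ i)))

theorem cesaro_apply (a : G) (φ : WeakDual ℝ (G →ᵇ ℝ)) (n : ℕ) (f : G →ᵇ ℝ) :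
    cesaro a φ n f =
      (n + 1 : ℝ)⁻¹ * ∑ i ∈ Finset.range (n + 1), φ (rightTranslate (a ^ i) f) := by
  change ((n + 1 : ℝ)⁻¹ • ∑ i ∈ Finset.range (n + 1),
    (WeakDual.toStrongDual φ).comp (rightTranslateCLM (a ^ i))) f = _
  rw [_root_.smul_apply, _root_.sum_apply]
  rfl

theorem cesaro_mem_means (a : G) {φ : WeakDual ℝ (G →ᵇ ℝ)} (hφ : φ ∈ means G) (n : ℕ) :
    cesaro a φ n ∈ means G := by
  have hn : (0 : ℝ) < n + 1 := by positivity
  constructor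
  · intro f
    rw [cesaro_apply, abs_mul, abs_of_pos (inv_pos.2 hn), inv_mul_le_iff₀ hn]
    refine (Finset.abs_sum_le_sum_abs _ _).trans ?_
    refine (Finset.sum_le_card_nsmul _ _ ‖f‖ fun i _ =>
      (hφ.1 _).trans (norm_rightTranslate_le _ f)).trans ?_
    simp
  · rw [cesaro_apply]
    have : ∀ i, rightTranslate (a ^ i) (1 : G →ᵇ ℝ) = 1 := fun i => rfl
    simp [this, hφ.2, hn.ne']

/-- The difference of the two sums telescopes to two end terms, each at most ‖f‖ in absolute value.
-/
theorem abs_cesaro_rightTranslate_sub_le (a : G) {φ : WeakDual ℝ (G →ᵇ ℝ)} (hφ : φ ∈ means G)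
    (n : ℕ) (f : G →ᵇ ℝ) :
    |cesaro a φ n (rightTranslate a f) - cesaro a φ n f| ≤ 2 * ‖f‖ * (1 / (n + 1 : ℝ)) := by
  have hn : (0 : ℝ) < n + 1 := by positivity
  rw [cesaro_apply, cesaro_apply, ← mul_sub, ← Finset.sum_sub_distrib]
  simp only [← rightTranslate_mul, ← pow_succ]
  rw [Finset.sum_range_sub (fun i => φ (rightTranslate (a ^ i) f)), abs_mul,
    abs_of_pos (inv_pos.2 hn), inv_mul_le_iff₀ hn]
  have h : ∀ i, |φ (rightTranslate (a ^ i) f)| ≤ ‖f‖ := fun i =>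
    (hφ.1 _).trans (norm_rightTranslate_le _ f)
  have := (abs_sub _ _).trans (add_le_add (h (n + 1)) (h 0))
  field_simp
  linarith

/-- A limit of the Cesàro averages of φ along a is invariant under a. Commutation of a with T is
needed only as far as φ can see it; it keeps every average, and hence the limit, invariant under T.
-/
theorem exists_mem_invariantMeans_insert {T : Set G} {φ : WeakDual ℝ (G →ᵇ ℝ)}
    (hφ : φ ∈ invariantMeans T) (a : G)
    (ha : ∀ t ∈ T, ∀ (i : ℕ) (f : G →ᵇ ℝ),
      φ (rightTranslate (a ^ i * t) f) = φ (rightTranslate (t * a ^ i) f)) :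
    ∃ ψ ∈ invariantMeans T, ∀ f, ψ (rightTranslate a f) = ψ f := by
  have hmem : ∀ n, cesaro a φ n ∈ invariantMeans T := by
    refine fun n => ⟨cesaro_mem_means a hφ.1 n, fun t ht f => ?_⟩
    rw [cesaro_apply, cesaro_apply]
    congr 1
    refine Finset.sum_congr rfl fun i _ => ?_
    rw [← rightTranslate_mul, ha t ht, rightTranslate_mul, hφ.2 t ht]
  -- The weak-* dual need not be metrisable, so the limit is taken along a nonprincipal ultrafilter
  -- on ℕ rather than along a subsequence.
  obtain ⟨ψ, hψ, hlim⟩ := (isCompact_invariantMeans T).ultrafilter_le_nhds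
    (Ultrafilter.map (cesaro a φ) (hyperfilter ℕ))
    (Filter.le_principal_iff.2 (Filter.Eventually.of_forall hmem :
      ∀ᶠ n in hyperfilter ℕ, cesaro a φ n ∈ invariantMeans T))
  have hev : ∀ f, Tendsto (fun n => cesaro a φ n f) (hyperfilter ℕ) (𝓝 (ψ f)) := fun f =>
    ((WeakDual.eval_continuous f).tendsto ψ).comp hlim
  refine ⟨ψ, hψ, fun f => ?_⟩
  have h1 := (hev (rightTranslate a f)).sub (hev f)
  have h2 : Tendsto (fun n => cesaro a φ n (rightTranslate a f) - cesaro a φ n f) atTop (𝓝 0) := by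
    refine squeeze_zero_norm (fun n => abs_cesaro_rightTranslate_sub_le a hφ.1 n f) ?_
    simpa using tendsto_one_div_add_atTop_nhds_zero_nat.const_mul (2 * ‖f‖)
  exact sub_eq_zero.1 (tendsto_nhds_unique h1 (h2.mono_left Nat.hyperfilter_le_atTop))

/-- Since ab = ⁅a, b⁆ba, an N-invariant mean does not distinguish ab from ba for a in N'. Elements
of N' can therefore be adjoined one at a time, and compactness passes from finite subsets to all of
N'. -/
theorem invariantMeans_nonempty_of_commutator {N N' : Subgroup G}
    (hN : ∀ a ∈ N', ∀ b, ⁅a, b⁆ ∈ N) (hne : (invariantMeans (N : Set G)).Nonempty) :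
    (invariantMeans (N' : Set G)).Nonempty := by
  classical
  have hcomm : ∀ φ ∈ invariantMeans (N : Set G), ∀ a ∈ N', ∀ b f,
      φ (rightTranslate (a * b) f) = φ (rightTranslate (b * a) f) := by
    intro φ hφ a ha b f
    have : a * b = ⁅a, b⁆ * (b * a) := by rw [commutatorElement_def]; group
    rw [this, rightTranslate_mul, hφ.2 _ (hN a ha b)]
  have hfin : ∀ S : Finset N',
      (invariantMeans ((N : Set G) ∪ (S.image Subtype.val : Finset G))).Nonempty := by
    intro S
    induction S using Finset.induction_on with
    | empty => simpa using hne
    | insert a S _ ih =>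
      obtain ⟨φ, hφ⟩ := ih
      obtain ⟨ψ, hψ, hψa⟩ := exists_mem_invariantMeans_insert hφ a.1 fun t _ i f =>
        hcomm φ ⟨hφ.1, fun t ht => hφ.2 t (Or.inl ht)⟩ _ (N'.pow_mem a.2 i) t f
      refine ⟨ψ, hψ.1, fun t ht f => ?_⟩
      simp only [Finset.image_insert, Finset.coe_insert, Set.union_insert, Set.mem_insert_iff] at ht
      rcases ht with rfl | ht
      · exact hψa f
      · exact hψ.2 t ht f
  obtain ⟨φ, hφ⟩ := (isCompact_invariantMeans (N : Set G)).inter_iInter_nonempty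
    (fun a : N' => {φ | ∀ t ∈ ({a.1} : Set G), ∀ f, φ (rightTranslate t f) = φ f})
    (fun a => isClosed_setOf_invariant _) (fun S => by
      obtain ⟨φ, hφ⟩ := hfin S
      refine ⟨φ, ⟨hφ.1, fun t ht => hφ.2 t (Or.inl ht)⟩, ?_⟩
      simp only [Set.mem_iInter]
      rintro a ha t rfl
      exact hφ.2 _ (Or.inr (by simpa using ha)))
  simp only [Set.mem_inter_iff, Set.mem_iInter] at hφ
  exact ⟨φ, hφ.1.1, fun t ht => hφ.2 ⟨t, ht⟩ t rfl⟩

/-- Nilpotent groups are amenable. -/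
theorem exists_invariant_mean [Group.IsNilpotent G] :
    ∃ φ : (G →ᵇ ℝ) →L[ℝ] ℝ, φ 1 = 1 ∧ ∀ g f, φ (rightTranslate g f) = φ f := by
  -- Climb the upper central series, starting from evaluation at 1, which is invariant under the
  -- trivial subgroup.
  have key : ∀ n, (invariantMeans (Subgroup.upperCentralSeries G n : Set G)).Nonempty := by
    intro n
    induction n with
    | zero =>
      let ev : (G →ᵇ ℝ) →L[ℝ] ℝ := evalCLM ℝ (1 : G)
      refine ⟨WeakDual.toStrongDual.symm ev, ⟨fun f => f.norm_coe_le_norm 1, rfl⟩, fun t ht f => ?_⟩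
      rw [Subgroup.upperCentralSeries_zero] at ht
      obtain rfl : t = 1 := by simpa using ht
      congr 1
      ext x
      simp [rightTranslate_apply]
    | succ n ih =>
      exact invariantMeans_nonempty_of_commutator
        (fun a ha b => Subgroup.mem_upperCentralSeries_succ_iff.1 ha b) ih
  obtain ⟨n, hn⟩ := Group.IsNilpotent.nilpotent G
  obtain ⟨φ, hφ⟩ := key n
  rw [hn] at hφ
  exact ⟨WeakDual.toStrongDual φ, hφ.1.2, fun g f => hφ.2 g trivial f⟩

end InvariantMean

/-! ### Types under pullback, averaging and dimension bounds -/

section PointwiseTypes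

variable {V W : Type*} [AddCommGroup V] [Module ℝ V] [AddCommGroup W] [Module ℝ W]

/-- A map that intertwines the two endomorphisms intertwines the rotations `rot`, and the projection
is a combination of pullbacks by these. -/
theorem typeComponent_compLinearMap {JV : V →ₗ[ℝ] V} {JW : W →ₗ[ℝ] W} {L : V →ₗ[ℝ] W}
    (hL : ∀ v, JW (L v) = L (JV v)) {k : ℕ} (p q : ℤ) (η : W [⋀^Fin k]→ₗ[ℝ] ℂ) :
    typeComponent JV p q (η.compLinearMap L) = (typeComponent JW p q η).compLinearMap L := by
  unfold typeComponent
  split_ifs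
  · ext v
    rw [AlternatingMap.compLinearMap_apply, alternating_sum_apply, alternating_sum_apply]
    refine Finset.sum_congr rfl fun j _ => ?_
    refine congrArg (fun w => fourierCoeff k p q j • η w) (funext fun i => ?_)
    simp [rot, hL]
  · ext v
    rfl

theorem mem_typeSpace_iff [FiniteDimensional ℝ V] {J : V →ₗ[ℝ] V} (hJ : ∀ v, J (J v) = -v) {k : ℕ}
    {p q : ℤ} {η : V [⋀^Fin k]→ₗ[ℝ] ℂ} :
    η ∈ typeSpace J k p q ↔ typeComponent J p q η = η :=
  ⟨typeComponent_of_mem, fun h => h ▸ typeComponent_mem hJ p q η⟩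

/-- The space of covectors of type `(0, 1)`. -/
def zeroOneSpace (J : V →ₗ[ℝ] V) : Submodule ℂ (V →ₗ[ℝ] ℂ) where
  carrier := {α | IsZeroOne J α}
  add_mem' := fun {α β} h h' v => by
    rw [LinearMap.add_apply, LinearMap.add_apply, h v, h' v]
    ring
  zero_mem' := fun v => by simp
  smul_mem' := fun c α h v => by
    rw [LinearMap.smul_apply, LinearMap.smul_apply, h v, smul_eq_mul, smul_eq_mul]
    ring

/-- A covector α of type (0, 1) is determined by its real part, because Im α(v) = Re α(Jv). -/
theorem two_mul_finrank_zeroOneSpace_le [FiniteDimensional ℝ V] (J : V →ₗ[ℝ] V) :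
    2 * Module.finrank ℂ (zeroOneSpace J) ≤ Module.finrank ℝ V := by
  rw [← finrank_real_of_complex]
  let T : zeroOneSpace J →ₗ[ℝ] V →ₗ[ℝ] ℝ :=
    { toFun := fun α => Complex.reLm ∘ₗ α.1
      map_add' := fun α β => by ext v; simp
      map_smul' := fun c α => by ext v; simp }
  have hT : Function.Injective T := by
    refine (injective_iff_map_eq_zero T).2 fun α hα => Subtype.ext (LinearMap.ext fun v => ?_)
    have h1 : (α.1 v).re = 0 := congrArg (fun L => L v) hα
    have h2 : (α.1 (J v)).re = 0 := congrArg (fun L => L (J v)) hα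
    rw [α.2 v] at h2
    exact Complex.ext h1 (by simpa using h2)
  refine (LinearMap.finrank_le_finrank_of_injective hT).trans_eq ?_
  rw [Module.finrank_linearMap, Module.finrank_self, mul_one]

/-- The covectors indexed by T are too many to be linearly independent, and a relation among them is
a relation among columns of the determinant. -/
theorem wedge_eq_zero_of_card_lt [FiniteDimensional ℝ V] {J : V →ₗ[ℝ] V} {k : ℕ}
    {α : Fin k → V →ₗ[ℝ] ℂ} {T : Finset (Fin k)} (hα : ∀ i ∈ T, IsZeroOne J (α i))
    (hT : Module.finrank ℝ V < 2 * T.card) : wedge α = 0 := by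
  classical
  have hdim := two_mul_finrank_zeroOneSpace_le J
  have hfin : Module.Finite ℂ (zeroOneSpace J) := by
    have : Module.Finite ℂ (V →ₗ[ℝ] ℂ) := Module.Finite.of_restrictScalars_finite ℝ ℂ _
    infer_instance
  let β : T → zeroOneSpace J := fun i => ⟨α i, hα i i.2⟩
  have hdep : ¬ LinearIndependent ℂ β := fun h => by
    have := h.fintype_card_le_finrank
    rw [Fintype.card_coe] at this
    omega
  obtain ⟨c, hc, i, hi⟩ := Fintype.not_linearIndependent_iff.1 hdep
  ext v
  rw [wedge_apply]
  refine Matrix.exists_mulVec_eq_zero_iff.1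
    ⟨fun j => if h : j ∈ T then c ⟨j, h⟩ else 0, fun h => hi ?_, funext fun a => ?_⟩
  · simpa using congrFun h i
  · have h1 := congrArg (fun γ : zeroOneSpace J => γ.1 (v a)) hc
    simp only [Matrix.mulVec, dotProduct, Matrix.of_apply, Pi.zero_apply]
    rw [← Finset.sum_subset (Finset.subset_univ T) (fun j _ hj => by simp [hj]),
      ← Finset.sum_coe_sort]
    simp only [Subtype.coe_eta]
    simpa [β, mul_comm] using h1

/-- In real dimension 2n this excludes q > n, so that ∂̄ vanishes on forms of type (n-2, n). -/
theorem typeSpace_eq_bot_of_lt [FiniteDimensional ℝ V] (J : V →ₗ[ℝ] V) {k : ℕ} {p q : ℤ}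
    (hq : (Module.finrank ℝ V : ℤ) < 2 * q) : typeSpace J k p q = ⊥ := by
  rw [typeSpace, Submodule.span_eq_bot]
  rintro η ⟨S, α, -, hc, -, h2, rfl⟩
  refine wedge_eq_zero_of_card_lt (J := J) (T := Sᶜ) (fun i hi => h2 i (by simpa using hi)) ?_
  omega

theorem finite_alternatingMap [FiniteDimensional ℝ V] (k : ℕ) :
    Module.Finite ℂ (V [⋀^Fin k]→ₗ[ℝ] ℂ) := by
  have : FiniteDimensional ℝ (V [⋀^Fin k]→ₗ[ℝ] ℂ) :=
    FiniteDimensional.of_injective (V₂ := MultilinearMap ℝ (fun _ : Fin k => V) ℂ)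
      { toFun := AlternatingMap.toMultilinearMap, map_add' := fun _ _ => rfl,
        map_smul' := fun _ _ => rfl } AlternatingMap.coe_multilinearMap_injective
  exact Module.Finite.of_restrictScalars_finite ℝ ℂ _

/-- The values of a linear functional on a family of alternating maps. -/
def averageAlternating {G : Type*} (Φ : (G → ℂ) →ₗ[ℂ] ℂ) {k : ℕ} (A : G → V [⋀^Fin k]→ₗ[ℝ] ℂ) :
    V [⋀^Fin k]→ₗ[ℝ] ℂ where
  toFun v := Φ fun g => A g v
  map_update_add' v i x y := by
    rw [← map_add]
    exact congrArg Φ (funext fun g => (A g).map_update_add v i x y)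
  map_update_smul' v i c x := by
    rw [← LinearMap.map_smul_of_tower]
    exact congrArg Φ (funext fun g => (A g).map_update_smul v i c x)
  map_eq_zero_of_eq' v i j hv hij := by
    rw [← map_zero Φ]
    exact congrArg Φ (funext fun g => (A g).map_eq_zero_of_eq v hv hij)

/-- The projection acts on the arguments through finite sums and Φ acts on the values, so linearity
of Φ suffices. -/
theorem typeComponent_averageAlternating {G : Type*} (Φ : (G → ℂ) →ₗ[ℂ] ℂ) (J : V →ₗ[ℝ] V) {k : ℕ}
    (p q : ℤ) (A : G → V [⋀^Fin k]→ₗ[ℝ] ℂ) :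
    typeComponent J p q (averageAlternating Φ A) =
      averageAlternating Φ fun g => typeComponent J p q (A g) := by
  ext v
  change _ = Φ fun g => typeComponent J p q (A g) v
  unfold typeComponent
  split_ifs
  · simp only [alternating_sum_apply]
    have h1 : (fun g => ∑ j ∈ Finset.range (k + 1),
        (fourierCoeff k p q j • (A g).compLinearMap (rot J (angle k j))) v) =
        ∑ j ∈ Finset.range (k + 1),
          fourierCoeff k p q j • fun g => A g fun i => rot J (angle k j) (v i) := by
      funext g
      rw [Finset.sum_apply]
      rfl
    rw [h1, map_sum]
    refine Finset.sum_congr rfl fun j _ => ?_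
    rw [map_smul]
    rfl
  · exact (map_zero Φ).symm

end PointwiseTypes

/-! ### Finite-dimensionality of the cohomology of the Lie algebra -/

section LieFinite

variable {𝔤 : Type*} [LieRing 𝔤] [LieAlgebra ℝ 𝔤] {J : 𝔤 →ₗ[ℝ] 𝔤} {p q : ℤ}

theorem mem_lieZ_iff {α : LieForm 𝔤} :
    α ∈ lieZ J p q ↔ α ∈ lieA J p q ∧ lieDelbar J p q α = 0 := by
  constructor
  · rintro ⟨α, hα, rfl⟩
    exact ⟨α.2, hα⟩
  · rintro ⟨h1, h2⟩
    exact ⟨⟨α, h1⟩, h2, rfl⟩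

theorem finite_lieA [FiniteDimensional ℝ 𝔤] : Module.Finite ℂ (lieA J p q) := by
  -- A `LieForm` has infinitely many components, but one of type (p, q) lives in degree p + q only.
  have := finite_alternatingMap (V := 𝔤) (p + q).toNat
  let T : lieA J p q →ₗ[ℂ] 𝔤 [⋀^Fin (p + q).toNat]→ₗ[ℝ] ℂ :=
    { toFun := fun α => α.1 (p + q).toNat, map_add' := fun _ _ => rfl, map_smul' := fun _ _ => rfl }
  refine Module.Finite.of_injective T ((injective_iff_map_eq_zero T).2 fun α hα => ?_)
  refine Subtype.ext (funext fun k => ?_)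
  by_cases h : 0 ≤ p ∧ 0 ≤ q ∧ p + q = k
  · obtain rfl : k = (p + q).toNat := by omega
    exact hα
  · have := α.2 k
    rwa [typeSpace_eq_bot h, Submodule.mem_bot] at this

theorem finite_lieDolbeault [FiniteDimensional ℝ 𝔤] : Module.Finite ℂ (LieDolbeault J p q) := by
  have := finite_lieA (J := J) (p := p) (q := q)
  have h : Module.Finite ℂ (lieZ J p q) := by
    unfold lieZ
    infer_instance
  infer_instance

end LieFinite
-- The left-invariant frame projected to M
section Frame

open Filter Topology
open scoped Manifold ContDiff

variable {E : Type*} [NormedAddCommGroup E] [NormedSpace ℝ E]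
  {G : Type*} [TopologicalSpace G] [ChartedSpace E G] [Group G]
  {M : Type*} [TopologicalSpace M] [ChartedSpace E M]

/-- The derivative of a map between manifolds, as a linear map between the model spaces. -/
abbrev modelDeriv {N N' : Type*} (E E' : Type*) [NormedAddCommGroup E] [NormedSpace ℝ E]
    [NormedAddCommGroup E'] [NormedSpace ℝ E'] [TopologicalSpace N] [ChartedSpace E N]
    [TopologicalSpace N'] [ChartedSpace E' N'] (f : N → N') (x : N) : E →L[ℝ] E' :=
  mfderiv 𝓘(ℝ, E) 𝓘(ℝ, E') f x

variable (E G) in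
/-- The inverse of the chart around `1`. -/
def expChart : E → G := (extChartAt 𝓘(ℝ, E) (1 : G)).symm

variable (E G) in
/-- The coordinates of `1`. -/
def expZero : E := extChartAt 𝓘(ℝ, E) (1 : G) 1

theorem expChart_expZero : expChart E G (expZero E G) = 1 :=
  extChartAt_to_inv (I := 𝓘(ℝ, E)) (1 : G)

theorem contMDiffAt_expChart [IsManifold 𝓘(ℝ, E) ∞ G] :
    ContMDiffAt 𝓘(ℝ, E) 𝓘(ℝ, E) ∞ (expChart E G) (expZero E G) :=
  (contMDiffOn_extChartAt_symm (1 : G)).contMDiffAt (extChartAt_target_mem_nhds (1 : G))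

/-- The left-invariant frame, projected to `M`. -/
def frame (π : G → M) (g : G) : E →L[ℝ] E :=
  modelDeriv E E (fun z => π (g * expChart E G z)) (expZero E G)

/-- The derivative of a function on `G` along a left-invariant vector field. -/
def lder (X : E) (F : G → ℂ) (g : G) : ℂ :=
  fderiv ℝ (fun z => F (g * expChart E G z)) (expZero E G) X

/-- The tangent space at 1 is identified with E through the chart at 1, so no Jacobian appears. This
is why differentiating z ↦ g * `expChart` z at `expZero` in the direction X gives the left-invariant
field with value X at 1; no exponential map is needed. -/
theorem hasMFDerivAt_expChart [IsManifold 𝓘(ℝ, E) ∞ G] :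
    HasMFDerivAt 𝓘(ℝ, E) 𝓘(ℝ, E) (expChart E G) (expZero E G) (ContinuousLinearMap.id ℝ E) := by
  have : IsManifold 𝓘(ℝ, E) 1 G := IsManifold.of_le (n := ∞) (by simp)
  have h := mfderivWithin_range_extChartAt_symm (I := 𝓘(ℝ, E)) (x := (1 : G))
  rw [ModelWithCorners.range_eq_univ, mfderivWithin_univ] at h
  exact ((contMDiffAt_expChart (E := E) (G := G)).mdifferentiableAt
    (by simp)).hasMFDerivAt.congr_mfderiv h

/-- Left translation by Γ is invisible after π, so the frame descends to M. -/
theorem frame_eq_of_fiber {Γ : Subgroup G} {π : G → M} (hπ : IsQuotientManifold E Γ π) {g h : G}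
    (hgh : π g = π h) : frame (E := E) π g = frame π h := by
  obtain ⟨γ, hγ, rfl⟩ := (hπ.eq_iff g h).1 hgh
  have : (fun z => π (γ * g * expChart E G z)) = fun z => π (g * expChart E G z) :=
    funext fun z => ((hπ.eq_iff _ _).2 ⟨γ, hγ, (mul_assoc _ _ _).symm⟩).symm
  unfold frame
  rw [this]

variable [LieGroup 𝓘(ℝ, E) ∞ G]

theorem isManifold_of_lieGroup (E : Type*) [NormedAddCommGroup E] [NormedSpace ℝ E] (G : Type*)
    [TopologicalSpace G] [ChartedSpace E G] [Group G] [LieGroup 𝓘(ℝ, E) ∞ G] :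
    IsManifold 𝓘(ℝ, E) ∞ G := (inferInstance : ContMDiffMul 𝓘(ℝ, E) ∞ G).toIsManifold

theorem contMDiffAt_mul_expChart (g : G) :
    ContMDiffAt 𝓘(ℝ, E) 𝓘(ℝ, E) ∞ (fun z => g * expChart E G z) (expZero E G) := by
  have := isManifold_of_lieGroup E G
  exact (contMDiff_mul_left (I := 𝓘(ℝ, E)) (n := ∞) (a := g)).contMDiffAt.comp _ contMDiffAt_expChart

theorem hasMFDerivAt_mul_expChart (g : G) :
    HasMFDerivAt 𝓘(ℝ, E) 𝓘(ℝ, E) (fun z => g * expChart E G z) (expZero E G)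
      (modelDeriv E E (g * ·) (1 : G)) := by
  have := isManifold_of_lieGroup E G
  have h1 : HasMFDerivAt 𝓘(ℝ, E) 𝓘(ℝ, E) (g * ·) (expChart E G (expZero E G))
      (modelDeriv E E (g * ·) (1 : G)) := by
    rw [expChart_expZero]
    exact ((contMDiff_mul_left (I := 𝓘(ℝ, E)) (n := ∞) (a := g)).mdifferentiableAt
      (by simp)).hasMFDerivAt
  exact h1.comp _ hasMFDerivAt_expChart

theorem hasMFDerivAt_comp_mul_expChart {N : Type*} {E' : Type*} [NormedAddCommGroup E']
    [NormedSpace ℝ E'] [TopologicalSpace N] [ChartedSpace E' N]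
    {f : G → N} {g : G} (hf : MDifferentiableAt 𝓘(ℝ, E) 𝓘(ℝ, E') f g) :
    HasMFDerivAt 𝓘(ℝ, E) 𝓘(ℝ, E') (fun z => f (g * expChart E G z)) (expZero E G)
      ((modelDeriv E E' f g).comp (modelDeriv E E (g * ·) (1 : G))) := by
  have h1 : HasMFDerivAt 𝓘(ℝ, E) 𝓘(ℝ, E') f (g * expChart E G (expZero E G))
      (modelDeriv E E' f g) := by
    rw [expChart_expZero, mul_one]
    exact hf.hasMFDerivAt
  exact HasMFDerivAt.comp (f := fun z => g * expChart E G z) (expZero E G) h1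
    (hasMFDerivAt_mul_expChart g)

/-- The link with `mulInvariantVectorField`, in terms of which `IsInvariantField` is stated. -/
theorem frame_apply {π : G → M} {g : G} (hπ : MDifferentiableAt 𝓘(ℝ, E) 𝓘(ℝ, E) π g) (X : E) :
    frame π g X = (mfderiv 𝓘(ℝ, E) 𝓘(ℝ, E) π g
      (mulInvariantVectorField (I := 𝓘(ℝ, E)) (G := G) X g) : E) := by
  rw [frame, modelDeriv, (hasMFDerivAt_comp_mul_expChart hπ).mfderiv]
  rfl

end Frame
-- Local sections of π and forms in charts
section LocalSection

open Filter Topology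
open scoped Manifold ContDiff

variable {E : Type*} [NormedAddCommGroup E] [NormedSpace ℝ E]
  {G : Type*} [TopologicalSpace G] [ChartedSpace E G]
  {M : Type*} [TopologicalSpace M] [ChartedSpace E M]

/-- Near `y`, the map `σ` is a smooth local inverse of `π` followed by the chart around `x₀`. -/
structure IsLocalSection (π : G → M) (x₀ : M) (σ : E → G) (y : E) : Prop where
  mem : y ∈ (extChartAt 𝓘(ℝ, E) x₀).target
  smooth : ContMDiffAt 𝓘(ℝ, E) 𝓘(ℝ, E) ∞ σ y
  right : ∀ᶠ y' in 𝓝 y, π (σ y') = (extChartAt 𝓘(ℝ, E) x₀).symm y'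
  left : ∀ᶠ g in 𝓝 (σ y), σ (extChartAt 𝓘(ℝ, E) x₀ (π g)) = g

theorem exists_isLocalSection [IsManifold 𝓘(ℝ, E) ∞ M] {π : G → M}
    (hπ : IsLocalDiffeomorph 𝓘(ℝ, E) 𝓘(ℝ, E) ∞ π) (x₀ : M) {y₀ : E}
    (hy₀ : y₀ ∈ (extChartAt 𝓘(ℝ, E) x₀).target) {g₀ : G}
    (hg₀ : π g₀ = (extChartAt 𝓘(ℝ, E) x₀).symm y₀) :
    ∃ σ : E → G, σ y₀ = g₀ ∧ ∀ᶠ y in 𝓝 y₀, IsLocalSection π x₀ σ y := by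
  obtain ⟨Φ, hΦ, heq⟩ := hπ g₀
  set e := extChartAt 𝓘(ℝ, E) x₀ with he
  have hπΦ : π g₀ = Φ.toPartialEquiv g₀ := heq hΦ
  -- The inverse of the chart followed by the local inverse of π; it is a section at all nearby
  -- points, as required for differentiating identities that involve it.
  refine ⟨Φ.toPartialEquiv.symm ∘ e.symm, ?_, ?_⟩
  · rw [Function.comp_apply, ← hg₀, hπΦ, Φ.toPartialEquiv.left_inv hΦ]
  have hopen : IsOpen e.target := isOpen_extChartAt_target x₀
  have hU : ∀ᶠ y in 𝓝 y₀, y ∈ e.target ∧ e.symm y ∈ Φ.toPartialEquiv.target := by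
    refine Filter.Eventually.and (hopen.mem_nhds hy₀) ?_
    refine (continuousAt_extChartAt_symm'' hy₀).eventually (Φ.open_target.mem_nhds ?_)
    change e.symm y₀ ∈ _
    rw [← hg₀, hπΦ]
    exact Φ.toPartialEquiv.map_source hΦ
  filter_upwards [hU.eventually_nhds] with y hy
  obtain ⟨hy1, hy2⟩ := hy.self_of_nhds
  have hright : ∀ y', y' ∈ e.target ∧ e.symm y' ∈ Φ.toPartialEquiv.target →
      π ((Φ.toPartialEquiv.symm ∘ e.symm) y') = e.symm y' := fun y' h => by
    have h1 : Φ.toPartialEquiv.symm (e.symm y') ∈ Φ.toPartialEquiv.source :=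
      Φ.toPartialEquiv.map_target h.2
    exact (heq h1).trans (Φ.toPartialEquiv.right_inv h.2)
  refine ⟨hy1, ?_, hy.mono hright, ?_⟩
  · exact (Φ.contMDiffOn_invFun.contMDiffAt (Φ.open_target.mem_nhds hy2)).comp y
      ((contMDiffOn_extChartAt_symm x₀).contMDiffAt (hopen.mem_nhds hy1))
  · have h1 : Φ.toPartialEquiv.symm (e.symm y) ∈ Φ.toPartialEquiv.source :=
      Φ.toPartialEquiv.map_target hy2
    have h2 : ∀ᶠ g in 𝓝 (Φ.toPartialEquiv.symm (e.symm y)), π g ∈ e.source := by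
      refine hπ.contMDiff.continuous.continuousAt.eventually
        ((isOpen_extChartAt_source x₀).mem_nhds ?_)
      have := hright y ⟨hy1, hy2⟩
      rw [Function.comp_apply] at this
      rw [this]
      exact e.map_target hy1
    filter_upwards [h2, Φ.open_source.mem_nhds h1] with g hg1 hg2
    rw [Function.comp_apply, e.left_inv hg1]
    exact (congrArg _ (heq hg2)).trans (Φ.toPartialEquiv.left_inv hg2)

theorem IsLocalSection.map_eq {π : G → M} {x₀ : M} {σ : E → G} {y : E} (h : IsLocalSection π x₀ σ y) :
    π (σ y) = (extChartAt 𝓘(ℝ, E) x₀).symm y := h.right.self_of_nhds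

theorem IsLocalSection.map_mem {π : G → M} {x₀ : M} {σ : E → G} {y : E} (h : IsLocalSection π x₀ σ y) :
    π (σ y) ∈ (extChartAt 𝓘(ℝ, E) x₀).source :=
  h.map_eq ▸ (extChartAt 𝓘(ℝ, E) x₀).map_target h.mem

variable [Group G]

/-- The left-invariant frame in the chart around `x₀`. -/
def chartFrame (π : G → M) (x₀ : M) (g : G) : E →L[ℝ] E :=
  fderiv ℝ (fun z => extChartAt 𝓘(ℝ, E) x₀ (π (g * expChart E G z))) (expZero E G)

/-- A differential form on `M` in the left-invariant frame. -/
def coef {k : ℕ} (π : G → M) (η : (x : M) → TangentSpace 𝓘(ℝ, E) x [⋀^Fin k]→L[ℝ] ℂ) (g : G) :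
    E [⋀^Fin k]→L[ℝ] ℂ :=
  ContinuousAlternatingMap.compContinuousLinearMap (M := E) (M' := E) (η (π g)) (frame π g)

variable [LieGroup 𝓘(ℝ, E) ∞ G] {π : G → M}

theorem frame_eq_comp (hπ : IsLocalDiffeomorph 𝓘(ℝ, E) 𝓘(ℝ, E) ∞ π) (g : G) :
    frame π g = (modelDeriv E E π g).comp (modelDeriv E E (g * ·) (1 : G)) :=
  (hasMFDerivAt_comp_mul_expChart (hπ.mdifferentiable (by simp) g)).mfderiv

theorem chartFrame_eq_comp [IsManifold 𝓘(ℝ, E) ∞ M] (hπ : IsLocalDiffeomorph 𝓘(ℝ, E) 𝓘(ℝ, E) ∞ π)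
    {x₀ : M} {g : G} (hg : π g ∈ (extChartAt 𝓘(ℝ, E) x₀).source) :
    chartFrame π x₀ g = (modelDeriv E E (extChartAt 𝓘(ℝ, E) x₀) (π g)).comp (frame π g) := by
  have : IsManifold 𝓘(ℝ, E) 1 M := IsManifold.of_le (n := ∞) (by simp)
  have h1 : MDifferentiableAt 𝓘(ℝ, E) 𝓘(ℝ, E) (extChartAt 𝓘(ℝ, E) x₀) (π g) :=
    mdifferentiableAt_extChartAt (by simpa using hg)
  have h2 : HasMFDerivAt 𝓘(ℝ, E) 𝓘(ℝ, E) (extChartAt 𝓘(ℝ, E) x₀ ∘ π) g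
      ((modelDeriv E E (extChartAt 𝓘(ℝ, E) x₀) (π g)).comp (modelDeriv E E π g)) :=
    h1.hasMFDerivAt.comp g (hπ.mdifferentiable (by simp) g).hasMFDerivAt
  have h3 := hasMFDerivAt_comp_mul_expChart h2.mdifferentiableAt
  rw [frame_eq_comp hπ, chartFrame, ← mfderiv_eq_fderiv]
  refine h3.mfderiv.trans ?_
  rw [modelDeriv, h2.mfderiv]
  rfl

theorem modelDeriv_mul_left_isInvertible (g : G) :
    (modelDeriv E E (g * ·) (1 : G)).IsInvertible := by
  let Φ : Diffeomorph 𝓘(ℝ, E) 𝓘(ℝ, E) G G ∞ :=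
    ⟨Equiv.mulLeft g, contMDiff_mul_left, contMDiff_mul_left⟩
  exact ⟨Φ.mfderivToContinuousLinearEquiv (by simp) 1, rfl⟩

theorem chartFrame_isInvertible [IsManifold 𝓘(ℝ, E) ∞ M]
    (hπ : IsLocalDiffeomorph 𝓘(ℝ, E) 𝓘(ℝ, E) ∞ π)
    {x₀ : M} {g : G} (hg : π g ∈ (extChartAt 𝓘(ℝ, E) x₀).source) :
    (chartFrame (E := E) π x₀ g).IsInvertible := by
  have : IsManifold 𝓘(ℝ, E) 1 M := IsManifold.of_le (n := ∞) (by simp)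
  rw [chartFrame_eq_comp hπ hg, frame_eq_comp hπ]
  have h1 : (modelDeriv E E (extChartAt 𝓘(ℝ, E) x₀) (π g)).IsInvertible :=
    isInvertible_mfderiv_extChartAt (I := 𝓘(ℝ, E)) hg
  have h2 : (modelDeriv E E π g).IsInvertible :=
    ⟨hπ.mfderivToContinuousLinearEquiv (by simp) g, rfl⟩
  have h3 : (modelDeriv E E (g * ·) (1 : G)).IsInvertible :=
    modelDeriv_mul_left_isInvertible g
  exact h1.comp (h2.comp h3)

/-- The derivatives of the chart and of its inverse cancel. This is the dictionary between
coefficients on G and the chart expressions in which smoothness and d are defined. -/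
theorem coef_localSection [IsManifold 𝓘(ℝ, E) ∞ M] (hπ : IsLocalDiffeomorph 𝓘(ℝ, E) 𝓘(ℝ, E) ∞ π)
    {x₀ : M} {σ : E → G} {y : E} (h : IsLocalSection π x₀ σ y)
    {k : ℕ} (η : (x : M) → TangentSpace 𝓘(ℝ, E) x [⋀^Fin k]→L[ℝ] ℂ) :
    coef π η (σ y) = (inChart x₀ η y).compContinuousLinearMap (chartFrame π x₀ (σ y)) := by
  have : IsManifold 𝓘(ℝ, E) 1 M := IsManifold.of_le (n := ∞) (by simp)
  have hx := h.map_mem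
  have h1 : (modelDeriv E E (extChartAt 𝓘(ℝ, E) x₀).symm y).comp
      (modelDeriv E E (extChartAt 𝓘(ℝ, E) x₀) (π (σ y))) = ContinuousLinearMap.id ℝ E := by
    have := mfderivWithin_extChartAt_symm_comp_mfderiv_extChartAt' (I := 𝓘(ℝ, E)) hx
    rw [ModelWithCorners.range_eq_univ, mfderivWithin_univ, h.map_eq,
      (extChartAt 𝓘(ℝ, E) x₀).right_inv h.mem] at this
    rw [h.map_eq]
    exact this
  rw [chartFrame_eq_comp hπ hx]
  have h2 : ∀ v, modelDeriv E E (extChartAt 𝓘(ℝ, E) x₀).symm y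
      (modelDeriv E E (extChartAt 𝓘(ℝ, E) x₀) (π (σ y)) v) = v := fun v =>
    congrArg (fun L : E →L[ℝ] E => L v) h1
  ext v
  change (η (π (σ y)) : E [⋀^Fin k]→L[ℝ] ℂ) (fun i => frame (E := E) π (σ y) (v i)) =
    (η ((extChartAt 𝓘(ℝ, E) x₀).symm y) : E [⋀^Fin k]→L[ℝ] ℂ)
    (fun i => modelDeriv E E (extChartAt 𝓘(ℝ, E) x₀).symm y
      (modelDeriv E E (extChartAt 𝓘(ℝ, E) x₀) (π (σ y)) (frame (E := E) π (σ y) (v i))))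
  simp only [h2]
  rw [h.map_eq]

end LocalSection
-- Smooth families of alternating maps
section AlternatingSmooth

open scoped ContDiff

variable {E : Type*} [NormedAddCommGroup E] [NormedSpace ℝ E]
  {F : Type*} [NormedAddCommGroup F] [NormedSpace ℝ F]

theorem contDiffAt_alternating_apply {k : ℕ} {f : F → E [⋀^Fin k]→L[ℝ] ℂ} {u : Fin k → F → E}
    {y : F} (hf : ContDiffAt ℝ ∞ f y) (hu : ∀ i, ContDiffAt ℝ ∞ (u i) y) :
    ContDiffAt ℝ ∞ (fun x => f x fun i => u i x) y := by
  have h := ((ContinuousAlternatingMap.toContinuousMultilinearMapCLM ℝ (𝕜 := ℝ) (E := E) (F := ℂ)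
    (ι := Fin k)).analyticAt_uncurry_of_multilinear (x := (f y, fun i => u i y))).contDiffAt
    (n := ∞)
  exact h.comp y (hf.prodMk (contDiffAt_pi.2 hu))

/-- In finite dimension an alternating map depends linearly on its values on a basis, through a left
inverse of the evaluation map. -/
theorem contDiffAt_alternating_iff [FiniteDimensional ℝ E] {k : ℕ} {f : F → E [⋀^Fin k]→L[ℝ] ℂ}
    {y : F} : ContDiffAt ℝ ∞ f y ↔ ∀ v, ContDiffAt ℝ ∞ (fun x => f x v) y := by
  refine ⟨fun h v => contDiffAt_alternating_apply h fun _ => contDiffAt_const, fun h => ?_⟩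
  let b := Module.finBasis ℝ E
  let T : (E [⋀^Fin k]→L[ℝ] ℂ) →ₗ[ℝ] (Fin k → Fin (Module.finrank ℝ E)) → ℂ :=
    { toFun := fun η r => η fun i => b (r i), map_add' := fun _ _ => rfl,
      map_smul' := fun _ _ => rfl }
  have hT : LinearMap.ker T = ⊥ := by
    refine LinearMap.ker_eq_bot'.2 fun η hη => ?_
    refine ContinuousAlternatingMap.toAlternatingMap_injective (b.ext_alternating fun r _ => ?_)
    exact congrFun hη r
  have : FiniteDimensional ℝ (E [⋀^Fin k]→L[ℝ] ℂ) :=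
    FiniteDimensional.of_injective T (LinearMap.ker_eq_bot.1 hT)
  obtain ⟨S, hS⟩ := T.exists_leftInverse_of_injective hT
  have h1 : f = fun x => LinearMap.toContinuousLinearMap S (fun r => f x fun i => b (r i)) :=
    funext fun x => (congrArg (fun L => L (f x)) hS).symm
  rw [h1]
  exact (ContinuousLinearMap.contDiff _).contDiffAt.comp y (contDiffAt_pi.2 fun r => h _)

end AlternatingSmooth

/-! ### Smoothness of forms, frame and derivatives -/

section FrameSmooth

open Filter Topology
open scoped Manifold ContDiff

variable {E : Type*} [NormedAddCommGroup E] [NormedSpace ℝ E]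
  {G : Type*} [TopologicalSpace G] [ChartedSpace E G] [Group G] [LieGroup 𝓘(ℝ, E) ∞ G]
  {M : Type*} [TopologicalSpace M] [ChartedSpace E M]

/-- Smoothness jointly in base point and displacement is what makes the derivative in the second
variable smooth in the first. -/
theorem contMDiffAt_mul_expChart_prod {F : Type*} [NormedAddCommGroup F] [NormedSpace ℝ F]
    {σ : F → G} {y : F} (hσ : ContMDiffAt 𝓘(ℝ, F) 𝓘(ℝ, E) ∞ σ y) :
    ContMDiffAt 𝓘(ℝ, F × E) 𝓘(ℝ, E) ∞ (fun p : F × E => σ p.1 * expChart E G p.2)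
      (y, expZero E G) := by
  have := isManifold_of_lieGroup E G
  refine ContMDiffAt.mul ?_ ?_
  · exact hσ.comp (I := 𝓘(ℝ, F × E)) (y, expZero E G) contDiffAt_fst.contMDiffAt
  · exact contMDiffAt_expChart.comp (I := 𝓘(ℝ, F × E)) (y, expZero E G) contDiffAt_snd.contMDiffAt

variable {π : G → M}

theorem contDiffAt_chartFrame [IsManifold 𝓘(ℝ, E) ∞ M]
    (hπ : IsLocalDiffeomorph 𝓘(ℝ, E) 𝓘(ℝ, E) ∞ π) {x₀ : M} {σ : E → G} {y : E}
    (h : IsLocalSection π x₀ σ y) :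
    ContDiffAt ℝ ∞ (fun y' => chartFrame (E := E) π x₀ (σ y')) y := by
  have h1 : ContMDiffAt 𝓘(ℝ, E × E) 𝓘(ℝ, E) ∞
      (fun p : E × E => extChartAt 𝓘(ℝ, E) x₀ (π (σ p.1 * expChart E G p.2)))
      (y, expZero E G) := by
    have h2 : ContMDiffAt 𝓘(ℝ, E) 𝓘(ℝ, E) ∞ (fun g => extChartAt 𝓘(ℝ, E) x₀ (π g))
        (σ y * expChart E G (expZero E G)) := by
      rw [expChart_expZero, mul_one]
      exact (contMDiffAt_extChartAt' (by simpa using h.map_mem)).comp _ (hπ.contMDiff _)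
    exact ContMDiffAt.comp (g := fun g => extChartAt 𝓘(ℝ, E) x₀ (π g))
      (f := fun p : E × E => σ p.1 * expChart E G p.2) (y, expZero E G) h2
      (contMDiffAt_mul_expChart_prod h.smooth)
  exact ContDiffAt.fderiv (f := fun y' z => extChartAt 𝓘(ℝ, E) x₀ (π (σ y' * expChart E G z)))
    (g := fun _ => expZero E G) h1.contDiffAt contDiffAt_const (by simp)

theorem contDiffAt_chartFrame_inverse [CompleteSpace E] [IsManifold 𝓘(ℝ, E) ∞ M]
    (hπ : IsLocalDiffeomorph 𝓘(ℝ, E) 𝓘(ℝ, E) ∞ π) {x₀ : M} {σ : E → G} {y : E}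
    (h : IsLocalSection π x₀ σ y) :
    ContDiffAt ℝ ∞ (fun y' => (chartFrame (E := E) π x₀ (σ y')).inverse) y := by
  obtain ⟨e, he⟩ := chartFrame_isInvertible (E := E) hπ h.map_mem
  have := contDiffAt_map_inverse (𝕜 := ℝ) (n := ∞) e
  rw [he] at this
  exact this.comp y (contDiffAt_chartFrame hπ h)

omit [Group G] [LieGroup 𝓘(ℝ, E) ∞ G] in
theorem IsLocalSection.contMDiffAt_chart [IsManifold 𝓘(ℝ, E) ∞ M]
    (hπ : IsLocalDiffeomorph 𝓘(ℝ, E) 𝓘(ℝ, E) ∞ π) {x₀ : M} {σ : E → G} {y : E}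
    (h : IsLocalSection π x₀ σ y) :
    ContMDiffAt 𝓘(ℝ, E) 𝓘(ℝ, E) ∞ (fun g => extChartAt 𝓘(ℝ, E) x₀ (π g)) (σ y) :=
  (contMDiffAt_extChartAt' (by simpa using h.map_mem)).comp _ (hπ.contMDiff _)

omit [Group G] [LieGroup 𝓘(ℝ, E) ∞ G] in
theorem IsLocalSection.chart_map {x₀ : M} {σ : E → G} {y : E} (h : IsLocalSection π x₀ σ y) :
    extChartAt 𝓘(ℝ, E) x₀ (π (σ y)) = y := by
  rw [h.map_eq, (extChartAt 𝓘(ℝ, E) x₀).right_inv h.mem]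

/-- Near σ y, f is f ∘ σ composed with the chart of π, so the chain rule applies. -/
theorem lder_localSection [IsManifold 𝓘(ℝ, E) ∞ M]
    (hπ : IsLocalDiffeomorph 𝓘(ℝ, E) 𝓘(ℝ, E) ∞ π) {x₀ : M} {σ : E → G} {y : E}
    (h : IsLocalSection π x₀ σ y) {f : G → ℂ} (hf : DifferentiableAt ℝ (f ∘ σ) y) (X : E) :
    lder X f (σ y) = fderiv ℝ (f ∘ σ) y (chartFrame π x₀ (σ y) X) := by
  have hz : σ y * expChart E G (expZero E G) = σ y := by rw [expChart_expZero, mul_one]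
  have hcont : Tendsto (fun z => σ y * expChart E G z) (𝓝 (expZero E G)) (𝓝 (σ y)) := by
    have := (contMDiffAt_mul_expChart (E := E) (σ y)).continuousAt.tendsto
    rwa [hz] at this
  have heq : (fun z => f (σ y * expChart E G z)) =ᶠ[𝓝 (expZero E G)]
      (f ∘ σ) ∘ fun z => extChartAt 𝓘(ℝ, E) x₀ (π (σ y * expChart E G z)) := by
    filter_upwards [hcont.eventually h.left] with z hz
    rw [Function.comp_apply, Function.comp_apply, hz]
  have hd : DifferentiableAt ℝ (fun z => extChartAt 𝓘(ℝ, E) x₀ (π (σ y * expChart E G z)))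
      (expZero E G) :=
    (hasMFDerivAt_comp_mul_expChart (g := σ y)
      ((h.contMDiffAt_chart hπ).mdifferentiableAt (by simp))).mdifferentiableAt.differentiableAt
  have hy : extChartAt 𝓘(ℝ, E) x₀ (π (σ y * expChart E G (expZero E G))) = y := by
    rw [hz, h.chart_map]
  rw [lder, heq.fderiv_eq, fderiv_comp _ (by rwa [hy]) hd, hy]
  rfl

omit [Group G] [LieGroup 𝓘(ℝ, E) ∞ G] in
theorem IsLocalSection.contDiffAt_comp_iff [IsManifold 𝓘(ℝ, E) ∞ M]
    (hπ : IsLocalDiffeomorph 𝓘(ℝ, E) 𝓘(ℝ, E) ∞ π) {x₀ : M} {σ : E → G} {y : E}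
    (h : IsLocalSection π x₀ σ y) {f : G → ℂ} :
    ContDiffAt ℝ ∞ (f ∘ σ) y ↔ ContMDiffAt 𝓘(ℝ, E) 𝓘(ℝ, ℂ) ∞ f (σ y) := by
  refine ⟨fun hf => ?_, fun hf => (hf.comp y h.smooth).contDiffAt⟩
  have heq : f =ᶠ[𝓝 (σ y)] (f ∘ σ) ∘ fun g => extChartAt 𝓘(ℝ, E) x₀ (π g) := by
    filter_upwards [h.left] with g hg
    rw [Function.comp_apply, Function.comp_apply, hg]
  refine ContMDiffAt.congr_of_eventuallyEq ?_ heq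
  refine ContMDiffAt.comp (σ y) ?_ (h.contMDiffAt_chart hπ)
  rw [h.chart_map]
  exact hf.contMDiffAt

theorem IsSmoothForm.contDiffAt {k : ℕ}
    {η : (x : M) → TangentSpace 𝓘(ℝ, E) x [⋀^Fin k]→L[ℝ] ℂ} (h : IsSmoothForm η) {x₀ : M} {y : E}
    (hy : y ∈ (extChartAt 𝓘(ℝ, E) x₀).target) : ContDiffAt ℝ ∞ (inChart x₀ η) y :=
  (h x₀).contDiffAt ((isOpen_extChartAt_target x₀).mem_nhds hy)

theorem IsSmoothForm.contMDiff_coef [IsManifold 𝓘(ℝ, E) ∞ M]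
    (hπ : IsLocalDiffeomorph 𝓘(ℝ, E) 𝓘(ℝ, E) ∞ π) {k : ℕ}
    {η : (x : M) → TangentSpace 𝓘(ℝ, E) x [⋀^Fin k]→L[ℝ] ℂ} (h : IsSmoothForm η)
    (X : Fin k → E) : ContMDiff 𝓘(ℝ, E) 𝓘(ℝ, ℂ) ∞ fun g => coef π η g X := by
  intro g
  have hy := mem_extChartAt_target (I := 𝓘(ℝ, E)) (π g)
  obtain ⟨σ, hσ, hev⟩ := exists_isLocalSection hπ (π g) hy (extChartAt_to_inv (π g)).symm
  have hsec := hev.self_of_nhds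
  rw [← hσ, ← hsec.contDiffAt_comp_iff hπ]
  have heq : (fun g => coef π η g X) ∘ σ =ᶠ[𝓝 (extChartAt 𝓘(ℝ, E) (π g) (π g))]
      fun y => inChart (π g) η y fun i => chartFrame π (π g) (σ y) (X i) := by
    filter_upwards [hev] with y hy
    rw [Function.comp_apply, coef_localSection hπ hy]
    rfl
  refine ContDiffAt.congr_of_eventuallyEq ?_ heq
  exact contDiffAt_alternating_apply (h.contDiffAt hy) fun i =>
    (contDiffAt_chartFrame hπ hsec).clm_apply contDiffAt_const

/-- The frame is invertible with smooth inverse, so smooth coefficients on G give smooth chart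
expressions. With `IsSmoothForm.contMDiff_coef` this moves all smoothness questions to functions on
G. -/
theorem isSmoothForm_of_coef [FiniteDimensional ℝ E] [IsManifold 𝓘(ℝ, E) ∞ M]
    (hπ : IsLocalDiffeomorph 𝓘(ℝ, E) 𝓘(ℝ, E) ∞ π) (hs : Function.Surjective π) {k : ℕ}
    {η : (x : M) → TangentSpace 𝓘(ℝ, E) x [⋀^Fin k]→L[ℝ] ℂ}
    (h : ∀ X, ContMDiff 𝓘(ℝ, E) 𝓘(ℝ, ℂ) ∞ fun g => coef π η g X) : IsSmoothForm η := by
  have := FiniteDimensional.complete ℝ E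
  refine fun x₀ y hy => ContDiffAt.contDiffWithinAt ?_
  obtain ⟨g, hg⟩ := hs ((extChartAt 𝓘(ℝ, E) x₀).symm y)
  obtain ⟨σ, rfl, hev⟩ := exists_isLocalSection hπ x₀ hy hg
  have hsec := hev.self_of_nhds
  have hcoef : ContDiffAt ℝ ∞ (fun y => coef π η (σ y)) y :=
    contDiffAt_alternating_iff.2 fun X => (hsec.contDiffAt_comp_iff hπ).2 (h X _)
  rw [contDiffAt_alternating_iff]
  intro v
  have heq : (fun y => inChart x₀ η y v) =ᶠ[𝓝 y]
      fun y => coef π η (σ y) fun i => (chartFrame π x₀ (σ y)).inverse (v i) := by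
    filter_upwards [hev] with y hy
    rw [coef_localSection hπ hy]
    have hinv := chartFrame_isInvertible (E := E) hπ hy.map_mem
    change _ = inChart x₀ η y fun i => chartFrame π x₀ (σ y) _
    simp only [hinv.self_apply_inverse]
  refine ContDiffAt.congr_of_eventuallyEq ?_ heq
  exact contDiffAt_alternating_apply hcoef fun i =>
    (contDiffAt_chartFrame_inverse hπ hsec).clm_apply contDiffAt_const

theorem contMDiff_lder [IsManifold 𝓘(ℝ, E) ∞ M]
    (hπ : IsLocalDiffeomorph 𝓘(ℝ, E) 𝓘(ℝ, E) ∞ π) {f : G → ℂ}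
    (hf : ContMDiff 𝓘(ℝ, E) 𝓘(ℝ, ℂ) ∞ f) (X : E) :
    ContMDiff 𝓘(ℝ, E) 𝓘(ℝ, ℂ) ∞ (lder X f) := by
  intro g
  have hy := mem_extChartAt_target (I := 𝓘(ℝ, E)) (π g)
  obtain ⟨σ, hσ, hev⟩ := exists_isLocalSection hπ (π g) hy (extChartAt_to_inv (π g)).symm
  have hsec := hev.self_of_nhds
  have hfσ : ∀ y, IsLocalSection π (π g) σ y → ContDiffAt ℝ ∞ (f ∘ σ) y := fun y hy =>
    (hy.contDiffAt_comp_iff hπ).2 (hf _)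
  rw [← hσ, ← hsec.contDiffAt_comp_iff hπ]
  have heq : lder X f ∘ σ =ᶠ[𝓝 (extChartAt 𝓘(ℝ, E) (π g) (π g))]
      fun y => fderiv ℝ (f ∘ σ) y (chartFrame π (π g) (σ y) X) := by
    filter_upwards [hev] with y hy
    exact lder_localSection hπ hy ((hfσ y hy).differentiableAt (by simp)) X
  refine ContDiffAt.congr_of_eventuallyEq ?_ heq
  exact ((hfσ _ hsec).fderiv_right (by simp)).clm_apply
    ((contDiffAt_chartFrame hπ hsec).clm_apply contDiffAt_const)

end FrameSmooth
-- The exterior derivative in the left-invariant frame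
section ExteriorDerivative

open Filter Topology VectorField
open scoped Manifold ContDiff

variable {E : Type*} [NormedAddCommGroup E] [NormedSpace ℝ E]
  {G : Type*} [TopologicalSpace G] [ChartedSpace E G] [Group G] [LieGroup 𝓘(ℝ, E) ∞ G]
  {M : Type*} [TopologicalSpace M] [ChartedSpace E M] [IsManifold 𝓘(ℝ, E) ∞ M] {π : G → M}

/-- The chart of π and σ are inverse to each other, so pushing forward by one is pulling back by the
other. Written as a pullback, the frame inherits the naturality of Lie brackets. -/
theorem chartFrame_eq_mpullback (hπ : IsLocalDiffeomorph 𝓘(ℝ, E) 𝓘(ℝ, E) ∞ π) {x₀ : M} {σ : E → G}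
    {y : E} (h : IsLocalSection π x₀ σ y) (X : E) :
    chartFrame π x₀ (σ y) X = mpullback 𝓘(ℝ, E) 𝓘(ℝ, E) σ
      (mulInvariantVectorField (I := 𝓘(ℝ, E)) (G := G) X) y := by
  have hθ := (h.contMDiffAt_chart hπ).mdifferentiableAt (by simp)
  have hσ := h.smooth.mdifferentiableAt (by simp)
  have h1 : chartFrame π x₀ (σ y) X = modelDeriv E E (fun g => extChartAt 𝓘(ℝ, E) x₀ (π g)) (σ y)
      (mulInvariantVectorField (I := 𝓘(ℝ, E)) (G := G) X (σ y)) := by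
    rw [chartFrame, ← mfderiv_eq_fderiv]
    exact congrArg (fun L : E →L[ℝ] E => L X) (hasMFDerivAt_comp_mul_expChart hθ).mfderiv
  have h2 : (modelDeriv E E (fun g => extChartAt 𝓘(ℝ, E) x₀ (π g)) (σ y)).comp
      (modelDeriv E E σ y) = ContinuousLinearMap.id ℝ E := by
    refine (mfderiv_comp y hθ hσ).symm.trans ?_
    have : (fun g => extChartAt 𝓘(ℝ, E) x₀ (π g)) ∘ σ =ᶠ[𝓝 y] id := by
      filter_upwards [h.right, (isOpen_extChartAt_target x₀).mem_nhds h.mem] with z hz1 hz2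
      rw [Function.comp_apply, hz1, (extChartAt 𝓘(ℝ, E) x₀).right_inv hz2, id]
    rw [this.mfderiv_eq]
    exact mfderiv_id
  have h3 : (modelDeriv E E σ y).comp
      (modelDeriv E E (fun g => extChartAt 𝓘(ℝ, E) x₀ (π g)) (σ y)) =
        ContinuousLinearMap.id ℝ E := by
    have hσ' : MDifferentiableAt 𝓘(ℝ, E) 𝓘(ℝ, E) σ (extChartAt 𝓘(ℝ, E) x₀ (π (σ y))) := by
      rwa [h.chart_map]
    have h4 := (mfderiv_comp (σ y) hσ' hθ).symm
    have : σ ∘ (fun g => extChartAt 𝓘(ℝ, E) x₀ (π g)) =ᶠ[𝓝 (σ y)] id := h.left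
    rw [this.mfderiv_eq, h.chart_map] at h4
    exact h4.trans mfderiv_id
  rw [h1, mpullback_apply]
  exact congrArg (fun L : E →L[ℝ] E => L (mulInvariantVectorField (I := 𝓘(ℝ, E)) (G := G) X (σ y)))
    (ContinuousLinearMap.inverse_eq h3 h2).symm

theorem mlieBracket_apply_eq_lieBracket (V W : E → E) (y : E) :
    mlieBracket 𝓘(ℝ, E) V W y = lieBracket ℝ V W y := by
  have h := mlieBracketWithin_eq_lieBracketWithin (𝕜 := ℝ) (V := V) (W := W) (s := Set.univ)
  rw [lieBracketWithin_univ] at h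
  exact congrFun ((mlieBracketWithin_univ (I := 𝓘(ℝ, E)) (V := V) (W := W)).symm.trans h) y

variable (G) in
/-- The bracket of the Lie algebra of `G`, on the model space. -/
def modelBracket (X Y : E) : E :=
  Bracket.bracket (L := GroupLieAlgebra 𝓘(ℝ, E) G) (M := GroupLieAlgebra 𝓘(ℝ, E) G) X Y

theorem lieBracket_chartFrame [CompleteSpace E]
    (hπ : IsLocalDiffeomorph 𝓘(ℝ, E) 𝓘(ℝ, E) ∞ π) {x₀ : M} {σ : E → G}
    {y : E} (h : ∀ᶠ z in 𝓝 y, IsLocalSection π x₀ σ z) (X Y : E) :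
    lieBracket ℝ (fun z => chartFrame (E := E) π x₀ (σ z) X)
      (fun z => chartFrame (E := E) π x₀ (σ z) Y) y =
        chartFrame (E := E) π x₀ (σ y) (modelBracket G X Y) := by
  have hsec := h.self_of_nhds
  have heq : ∀ X : E, (fun z => chartFrame (E := E) π x₀ (σ z) X) =ᶠ[𝓝 y]
      mpullback 𝓘(ℝ, E) 𝓘(ℝ, E) σ (mulInvariantVectorField (I := 𝓘(ℝ, E)) (G := G) X) := fun X => by
    filter_upwards [h] with z hz
    exact chartFrame_eq_mpullback hπ hz X
  have := isManifold_of_lieGroup E G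
  have h1 := mpullback_mlieBracket (n := ∞) (I := 𝓘(ℝ, E)) (I' := 𝓘(ℝ, E)) (f := σ) (x₀ := y)
    (mdifferentiableAt_mulInvariantVectorField (I := 𝓘(ℝ, E)) (G := G) X)
    (mdifferentiableAt_mulInvariantVectorField (I := 𝓘(ℝ, E)) (G := G) Y) hsec.smooth
    (by rw [minSmoothness_of_isRCLikeNormedField]; exact ENat.LEInfty.out)
  have h2 : mulInvariantVectorField (I := 𝓘(ℝ, E)) (G := G) (modelBracket (E := E) G X Y) =
      mlieBracket 𝓘(ℝ, E) (mulInvariantVectorField (I := 𝓘(ℝ, E)) (G := G) X)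
        (mulInvariantVectorField (I := 𝓘(ℝ, E)) (G := G) Y) :=
    mulInvariantVector_mlieBracket (I := 𝓘(ℝ, E)) (G := G) X Y
  rw [← h2, ← (heq X).mlieBracket_vectorField_eq (heq Y)] at h1
  exact (mlieBracket_apply_eq_lieBracket _ _ y).symm.trans
    (h1.symm.trans (chartFrame_eq_mpullback hπ hsec _).symm)

theorem coef_extD (hπ : IsLocalDiffeomorph 𝓘(ℝ, E) 𝓘(ℝ, E) ∞ π) {k : ℕ}
    (η : (x : M) → TangentSpace 𝓘(ℝ, E) x [⋀^Fin k]→L[ℝ] ℂ) {g : G} {σ : E → G}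
    (hσ : σ (extChartAt 𝓘(ℝ, E) (π g) (π g)) = g) (X : Fin (k + 1) → E) :
    coef π (extD η) g X = extDeriv (inChart (π g) η) (extChartAt 𝓘(ℝ, E) (π g) (π g))
      fun i => chartFrame π (π g) (σ (extChartAt 𝓘(ℝ, E) (π g) (π g))) (X i) := by
  have h1 : ∀ v, chartFrame π (π g) g v =
      modelDeriv E E (extChartAt 𝓘(ℝ, E) (π g)) (π g) (frame π g v) := fun v => by
    rw [chartFrame_eq_comp hπ (mem_extChartAt_source (π g))]
    rfl
  simp only [hσ, h1]
  rfl

theorem lder_coef (hπ : IsLocalDiffeomorph 𝓘(ℝ, E) 𝓘(ℝ, E) ∞ π) {k : ℕ}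
    {η : (x : M) → TangentSpace 𝓘(ℝ, E) x [⋀^Fin k]→L[ℝ] ℂ} (hη : IsSmoothForm η) {g : G} {σ : E → G}
    (hσ : σ (extChartAt 𝓘(ℝ, E) (π g) (π g)) = g)
    (hev : ∀ᶠ y in 𝓝 (extChartAt 𝓘(ℝ, E) (π g) (π g)), IsLocalSection π (π g) σ y)
    (Z : E) (Y : Fin k → E) : lder Z (fun h => coef π η h Y) g =
      fderiv ℝ (fun y => inChart (π g) η y fun i => chartFrame π (π g) (σ y) (Y i))
        (extChartAt 𝓘(ℝ, E) (π g) (π g))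
        (chartFrame π (π g) (σ (extChartAt 𝓘(ℝ, E) (π g) (π g))) Z) := by
  have hsec := hev.self_of_nhds
  have h1 : ContDiffAt ℝ ∞ ((fun h => coef π η h Y) ∘ σ) (extChartAt 𝓘(ℝ, E) (π g) (π g)) :=
    (hsec.contDiffAt_comp_iff hπ).2 (hη.contMDiff_coef hπ Y _)
  have h2 := lder_localSection hπ hsec (h1.differentiableAt (by simp)) Z
  rw [hσ] at h2
  rw [h2, hσ]
  refine congrArg (fun L : E →L[ℝ] ℂ => L _) (Filter.EventuallyEq.fderiv_eq ?_)
  filter_upwards [hev] with y hy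
  rw [Function.comp_apply, coef_localSection hπ hy]
  rfl

theorem coef_extD_zero (hπ : IsLocalDiffeomorph 𝓘(ℝ, E) 𝓘(ℝ, E) ∞ π)
    {η : (x : M) → TangentSpace 𝓘(ℝ, E) x [⋀^Fin 0]→L[ℝ] ℂ} (hη : IsSmoothForm η) (g : G)
    (X : Fin 1 → E) : coef π (extD η) g X = lder (X 0) (fun h => coef π η h ![]) g := by
  have hy := mem_extChartAt_target (I := 𝓘(ℝ, E)) (π g)
  obtain ⟨σ, hσ, hev⟩ := exists_isLocalSection hπ (π g) hy (extChartAt_to_inv (π g)).symm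
  have hsec := hev.self_of_nhds
  -- There is a single vector field, so the pairwise commutation hypothesis is vacuous.
  rw [coef_extD hπ η hσ, extDeriv_apply_vectorField_of_pairwise_commute
    (V := fun i y => chartFrame (E := E) π (π g) (σ y) (X i)) (hη.differentiableAt (π g))
    (fun i => ((contDiffAt_chartFrame hπ hsec).clm_apply contDiffAt_const).differentiableAt
      (by simp)) (fun i j hij => (hij (Fin.ext (by omega))).elim), Fin.sum_univ_one,
    lder_coef hπ hη hσ hev, Fin.val_zero, pow_zero, one_smul]
  refine congrArg (fun L : E →L[ℝ] ℂ => L _) (congrArg (fun f => fderiv ℝ f _) ?_)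
  funext y
  congr 1
  exact Subsingleton.elim _ _

/-- The invariant formula for d on frame fields, whose brackets have constant coefficients. The
first sum will be killed by the mean; the second is the Chevalley–Eilenberg differential. -/
theorem coef_extD_succ [CompleteSpace E] (hπ : IsLocalDiffeomorph 𝓘(ℝ, E) 𝓘(ℝ, E) ∞ π) {m : ℕ}
    {η : (x : M) → TangentSpace 𝓘(ℝ, E) x [⋀^Fin (m + 1)]→L[ℝ] ℂ} (hη : IsSmoothForm η) (g : G)
    (X : Fin (m + 2) → E) :
    coef π (extD η) g X =
      (∑ i : Fin (m + 2), (-1 : ℂ) ^ (i : ℕ) * lder (X i) (fun h => coef π η h (i.removeNth X)) g) +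
        ∑ i : Fin (m + 1), ∑ j ≥ i, (-1 : ℂ) ^ ((i : ℕ) + ((j : ℕ) + 1)) *
          coef π η g (Matrix.vecCons (modelBracket G (X i.castSucc) (X j.succ))
            (j.removeNth <| i.castSucc.removeNth X)) := by
  have hy := mem_extChartAt_target (I := 𝓘(ℝ, E)) (π g)
  obtain ⟨σ, hσ, hev⟩ := exists_isLocalSection hπ (π g) hy (extChartAt_to_inv (π g)).symm
  have hsec := hev.self_of_nhds
  have hV : ∀ Z : E, DifferentiableAt ℝ (fun y => chartFrame (E := E) π (π g) (σ y) Z)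
      (extChartAt 𝓘(ℝ, E) (π g) (π g)) := fun Z =>
    ((contDiffAt_chartFrame hπ hsec).clm_apply contDiffAt_const).differentiableAt (by simp)
  have hd := fun (Z : E) (Y : Fin (m + 1) → E) => lder_coef hπ hη hσ hev Z Y
  have hc : ∀ v, coef π η g v = inChart (π g) η (extChartAt 𝓘(ℝ, E) (π g) (π g))
      fun i => chartFrame π (π g) (σ (extChartAt 𝓘(ℝ, E) (π g) (π g))) (v i) := fun v => by
    have := coef_localSection hπ hsec η
    rw [hσ] at this
    rw [this, hσ]
    rfl
  rw [coef_extD hπ η hσ, extDeriv_apply_vectorField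
    (V := fun i y => chartFrame (E := E) π (π g) (σ y) (X i)) (hη.differentiableAt (π g))
    (fun i => hV (X i)), sub_eq_add_neg, ← Finset.sum_neg_distrib]
  congr 1
  · refine Finset.sum_congr rfl fun i _ => ?_
    rw [hd, zsmul_eq_mul]
    push_cast
    rfl
  · refine Finset.sum_congr rfl fun i _ => ?_
    rw [← Finset.sum_neg_distrib]
    refine Finset.sum_congr rfl fun j _ => ?_
    -- The bracket terms come with a minus sign and exponent i + j; the sign is absorbed as the
    -- extra 1 in i + (j + 1).
    rw [lieBracket_chartFrame hπ hev, zsmul_eq_mul, ← add_assoc, pow_succ _ ((i : ℕ) + j)]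
    push_cast
    rw [mul_neg_one, neg_mul]
    rw [hc]
    congr 2
    refine congrArg (inChart (π g) η _) (funext fun l => ?_)
    refine Fin.cases ?_ (fun l => ?_) l <;> rfl

end ExteriorDerivative
-- A mean that kills left-invariant derivatives
section Mean

open Filter Topology BoundedContinuousFunction
open scoped Manifold ContDiff

variable {E : Type*} [NormedAddCommGroup E] [NormedSpace ℝ E]
  {G : Type*} [TopologicalSpace G] [ChartedSpace E G] [Group G]
  {M : Type*} [TopologicalSpace M] [ChartedSpace E M] {Γ : Subgroup G} {π : G → M}

theorem IsQuotientManifold.map_mul_eq (hπ : IsQuotientManifold E Γ π) {g h : G} (hgh : π g = π h)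
    (a : G) : π (g * a) = π (h * a) := by
  obtain ⟨γ, hγ, rfl⟩ := (hπ.eq_iff g h).1 hgh
  exact (hπ.eq_iff _ _).2 ⟨γ, hγ, (mul_assoc _ _ _).symm⟩

theorem lder_eq_of_fiber (hπ : IsQuotientManifold E Γ π) {f : G → ℂ}
    (hf : ∀ g h, π g = π h → f g = f h) (X : E) (g h : G) (hgh : π g = π h) :
    lder X f g = lder X f h := by
  have : (fun z => f (g * expChart E G z)) = fun z => f (h * expChart E G z) :=
    funext fun z => hf _ _ (hπ.map_mul_eq hgh _)
  rw [lder, lder, this]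

theorem exists_boundedContinuousFunction [CompactSpace M] (hπ : IsQuotientManifold E Γ π)
    {u : G → ℝ} (hu : Continuous u) (hf : ∀ g h, π g = π h → u g = u h) :
    ∃ v : G →ᵇ ℝ, ⇑v = u := by
  have hcont : Continuous π := hπ.isLocalDiffeomorph.contMDiff.continuous
  have hq : IsQuotientMap π := hπ.isLocalDiffeomorph.isOpenMap.isQuotientMap hcont hπ.surjective
  have h1 : (fun x => u (Function.surjInv hπ.surjective x)) ∘ π = u :=
    funext fun g => hf _ _ (Function.surjInv_eq hπ.surjective (π g))
  have h2 : Continuous fun x => u (Function.surjInv hπ.surjective x) := by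
    rw [hq.continuous_iff, h1]
    exact hu
  exact ⟨(mkOfCompact ⟨_, h2⟩).compContinuous ⟨π, hcont⟩, h1⟩

variable [LieGroup 𝓘(ℝ, E) ∞ G] [IsManifold 𝓘(ℝ, E) ∞ M]

/-- A first-order Taylor estimate, uniform in g: strict differentiability gives it near each point
of M, and compactness of M makes it global. -/
theorem eventually_abs_sub_le [CompactSpace M] (hπ : IsQuotientManifold E Γ π)
    {u : G → ℝ} (hu : ContMDiff 𝓘(ℝ, E) 𝓘(ℝ, ℝ) ∞ u) (hf : ∀ g h, π g = π h → u g = u h) {X : E}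
    {v : G → ℝ} (hv : ∀ g, v g = fderiv ℝ (fun z => u (g * expChart E G z)) (expZero E G) X)
    (hvc : Continuous v) {ε : ℝ} (hε : 0 < ε) :
    ∀ᶠ t : ℝ in 𝓝 0, ∀ g,
      |u (g * expChart E G (expZero E G + t • X)) - u g - t * v g| ≤ ε * |t| := by
  have hvf : ∀ g h, π g = π h → v g = v h := fun g h hgh => by
    have : (fun z => u (g * expChart E G z)) = fun z => u (h * expChart E G z) :=
      funext fun z => hf _ _ (hπ.map_mul_eq hgh _)
    rw [hv, hv, this]
  have key : ∀ᶠ t : ℝ in 𝓝 0, ∀ x ∈ (Set.univ : Set M), ∀ g, π g = x →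
      |u (g * expChart E G (expZero E G + t • X)) - u g - t * v g| ≤ ε * |t| := by
    refine isCompact_univ.eventually_forall_of_forall_eventually fun x _ => ?_
    have hy := mem_extChartAt_target (I := 𝓘(ℝ, E)) x
    obtain ⟨g₀, hg₀⟩ := hπ.surjective ((extChartAt 𝓘(ℝ, E) x).symm (extChartAt 𝓘(ℝ, E) x x))
    obtain ⟨σ, hσ, hev⟩ := exists_isLocalSection hπ.isLocalDiffeomorph x hy hg₀
    have hsec := hev.self_of_nhds
    set y₀ := extChartAt 𝓘(ℝ, E) x x with hy₀
    let U : E × E → ℝ := fun p => u (σ p.1 * expChart E G p.2)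
    have hU : ContDiffAt ℝ ∞ U (y₀, expZero E G) :=
      (ContMDiffAt.comp (g := u) (f := fun p : E × E => σ p.1 * expChart E G p.2)
        (y₀, expZero E G) (hu _) (contMDiffAt_mul_expChart_prod hsec.smooth)).contDiffAt
    have hstrict := hU.hasStrictFDerivAt (by simp)
    set D := fderiv ℝ U (y₀, expZero E G) with hD
    have hvD : v (σ y₀) = D (0, X) := by
      have h1 : HasFDerivAt (fun z : E => (y₀, z)) (ContinuousLinearMap.inr ℝ E E)
          (expZero E G) := hasFDerivAt_prodMk_right _ _
      have h2 := HasFDerivAt.comp (expZero E G) hstrict.hasFDerivAt h1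
      rw [hv, show (fun z => u (σ y₀ * expChart E G z)) = U ∘ fun z : E => (y₀, z) from rfl,
        h2.fderiv]
      rfl
    have hC : 0 < ‖X‖ + 1 := by positivity
    -- Half of ε pays for the linearisation at the fixed point y₀, the other half for the variation
    -- of v near it; the 1 added to ‖X‖ covers X = 0.
    have hlin := hstrict.isLittleO.def (show 0 < ε / 2 / (‖X‖ + 1) by positivity)
    have e1 : Tendsto (fun p : ℝ × M => extChartAt 𝓘(ℝ, E) x p.2) (𝓝 (0, x)) (𝓝 y₀) :=
      (continuousAt_extChartAt (I := 𝓘(ℝ, E)) x).tendsto.comp continuousAt_snd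
    have e2 : Tendsto (fun p : ℝ × M => expZero E G + p.1 • X) (𝓝 (0, x)) (𝓝 (expZero E G)) := by
      have : Continuous fun p : ℝ × M => expZero E G + p.1 • X := by fun_prop
      simpa using this.tendsto (0, x)
    have e3 := hlin.filter_mono le_rfl |> (((e1.prodMk_nhds e2).prodMk_nhds
      (e1.prodMk_nhds tendsto_const_nhds)).eventually)
    have e4 : ∀ᶠ y in 𝓝 y₀, |v (σ y) - D (0, X)| ≤ ε / 2 := by
      have h1 : Tendsto (fun y => v (σ y)) (𝓝 y₀) (𝓝 (D (0, X))) := by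
        rw [← hvD]
        exact (hvc.tendsto _).comp hsec.smooth.continuousAt.tendsto
      filter_upwards [h1.eventually (Metric.closedBall_mem_nhds _ (half_pos hε))] with y hy
      simpa [Real.dist_eq] using hy
    have e5 : ∀ᶠ p : ℝ × M in 𝓝 (0, x), p.2 ∈ (extChartAt 𝓘(ℝ, E) x).source :=
      continuousAt_snd.eventually (extChartAt_source_mem_nhds x)
    filter_upwards [e3, e1.eventually e4, e1.eventually hsec.right, e5] with p h1 h2 h3 h4 g hg
    set s := σ (extChartAt 𝓘(ℝ, E) x p.2) with hs
    rw [(extChartAt 𝓘(ℝ, E) x).left_inv h4, ← hg] at h3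
    -- An arbitrary g over a nearby point is traded for the value of the section in the same fibre.
    have hUg : ∀ a : G, u (g * a) = u (s * a) := fun a => hf _ _ (hπ.map_mul_eq h3.symm a)
    have hug : u g = u (s * expChart E G (expZero E G)) := by
      rw [← hUg, expChart_expZero, mul_one]
    rw [hUg, hug, hvf g s h3.symm]
    have h5 : |u (s * expChart E G (expZero E G + p.1 • X)) - u (s * expChart E G (expZero E G)) -
        p.1 * D (0, X)| ≤ ε / 2 * |p.1| := by
      have h6 : D ((0 : E), p.1 • X) = p.1 * D (0, X) := by
        rw [show ((0 : E), p.1 • X) = p.1 • ((0 : E), X) by simp, map_smul, smul_eq_mul]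
      simp only [Prod.mk_sub_mk, sub_self, add_sub_cancel_left, h6, Real.norm_eq_abs] at h1
      refine h1.trans ?_
      rw [Prod.norm_mk, norm_zero, norm_smul, Real.norm_eq_abs,
        max_eq_right (mul_nonneg (abs_nonneg _) (norm_nonneg _))]
      have h7 : ε / 2 / (‖X‖ + 1) * (|p.1| * ‖X‖) = ε / 2 * |p.1| * (‖X‖ / (‖X‖ + 1)) := by ring
      rw [h7]
      refine mul_le_of_le_one_right (by positivity) ?_
      rw [div_le_one hC]
      linarith
    have h8 : |p.1 * (v s - D (0, X))| ≤ ε / 2 * |p.1| := by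
      rw [abs_mul, mul_comm]
      exact mul_le_mul_of_nonneg_right h2 (abs_nonneg _)
    calc _ = |(u (s * expChart E G (expZero E G + p.1 • X)) -
          u (s * expChart E G (expZero E G)) - p.1 * D (0, X)) - p.1 * (v s - D (0, X))| := by
          congr 1; ring
      _ ≤ _ := (abs_sub _ _).trans (by linarith)
  filter_upwards [key] with t ht g using ht (π g) trivial g rfl

/-- By invariance φ kills the translation difference of u, which is t • v up to a uniform error
ε|t|; dividing by t gives |φ v| ≤ ‖φ‖ε for every ε. -/
theorem mean_derivative_eq_zero [CompactSpace M] (hπ : IsQuotientManifold E Γ π) [ContinuousMul G]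
    {φ : (G →ᵇ ℝ) →L[ℝ] ℝ} (hφ : ∀ g f, φ (rightTranslate g f) = φ f)
    {u : G → ℝ} (hu : ContMDiff 𝓘(ℝ, E) 𝓘(ℝ, ℝ) ∞ u) (hf : ∀ g h, π g = π h → u g = u h) {X : E}
    {v : G →ᵇ ℝ} (hv : ∀ g, v g = fderiv ℝ (fun z => u (g * expChart E G z)) (expZero E G) X) :
    φ v = 0 := by
  obtain ⟨w, hw⟩ := exists_boundedContinuousFunction hπ hu.continuous hf
  have hbound : ∀ ε > 0, |φ v| ≤ ‖φ‖ * ε := by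
    intro ε hε
    have h1 := (eventually_abs_sub_le hπ hu hf hv v.continuous hε).filter_mono
      (nhdsWithin_le_nhds (s := {0}ᶜ))
    obtain ⟨t, ht, ht0⟩ := (h1.and self_mem_nhdsWithin).exists
    have ht0' : (t : ℝ) ≠ 0 := ht0
    set a := expChart E G (expZero E G + t • X)
    have h2 : ‖rightTranslate a w - w - t • v‖ ≤ ε * |t| := by
      refine (norm_le (by positivity)).2 fun g => ?_
      have := ht g
      rw [← hw] at this
      exact this
    have h3 : φ (rightTranslate a w - w - t • v) = -(t * φ v) := by
      rw [map_sub, map_sub, hφ, map_smul, smul_eq_mul]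
      ring
    have h4 := (φ.le_opNorm _).trans (mul_le_mul_of_nonneg_left h2 (norm_nonneg φ))
    rw [h3, norm_neg, Real.norm_eq_abs, abs_mul, mul_comm |t|, ← mul_assoc] at h4
    exact le_of_mul_le_mul_right h4 (abs_pos.2 ht0')
  have h0 : |φ v| ≤ 0 := by
    refine le_of_forall_pos_le_add fun ε hε => ?_
    have := hbound (ε / (‖φ‖ + 1)) (by positivity)
    refine this.trans ?_
    rw [zero_add, mul_div_assoc', div_le_iff₀ (by positivity)]
    nlinarith [norm_nonneg φ]
  exact abs_nonpos_iff.1 h0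

/-- On the functions on `G`, there is a mean that kills the derivatives of the smooth functions on
`Γ \ G` along left-invariant fields. -/
theorem exists_mean [CompactSpace M] [Group.IsNilpotent G] (hπ : IsQuotientManifold E Γ π) :
    ∃ Φ : (G → ℂ) →ₗ[ℂ] ℂ, Φ (fun _ => 1) = 1 ∧
      (∀ f, (∀ g, (f g).im = 0) → (Φ f).im = 0) ∧
      ∀ f, ContMDiff 𝓘(ℝ, E) 𝓘(ℝ, ℂ) ∞ f → (∀ g h, π g = π h → f g = f h) →
        ∀ X : E, Φ (lder X f) = 0 := by
  have : ContinuousMul G := continuousMul_of_contMDiffMul 𝓘(ℝ, E) ∞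
  obtain ⟨φ, hφ1, hφ⟩ := exists_invariant_mean (G := G)
  let ι : (G →ᵇ ℝ) →ₗ[ℝ] G → ℝ :=
    { toFun := fun f => f, map_add' := fun _ _ => rfl, map_smul' := fun _ _ => rfl }
  -- An arbitrary linear extension of the mean to all functions. Its values off the bounded
  -- continuous functions play no role, and averaging then needs no continuity proofs.
  obtain ⟨r, hr⟩ := ι.exists_leftInverse_of_injective
    (LinearMap.ker_eq_bot.2 fun f g h => DFunLike.coe_injective h)
  let Ψ : (G → ℝ) →ₗ[ℝ] ℝ := φ.toLinearMap ∘ₗ r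
  have hΨ : ∀ f : G →ᵇ ℝ, Ψ f = φ f := fun f => congrArg φ (congrArg (fun L => L f) hr)
  let Φ : (G → ℂ) →ₗ[ℂ] ℂ :=
    { toFun := fun f => ⟨Ψ fun g => (f g).re, Ψ fun g => (f g).im⟩
      map_add' := fun f f' => by
        apply Complex.ext
        · exact map_add Ψ (fun g => (f g).re) fun g => (f' g).re
        · exact map_add Ψ (fun g => (f g).im) fun g => (f' g).im
      map_smul' := fun c f => by
        have h1 : (fun g => ((c • f) g).re) = c.re • (fun g => (f g).re) - c.im • fun g => (f g).im :=
          rfl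
        have h2 : (fun g => ((c • f) g).im) = c.re • (fun g => (f g).im) + c.im • fun g => (f g).re :=
          rfl
        rw [h1, h2, map_sub, map_add]
        simp only [map_smul]
        rfl }
  have hder : ∀ f, ContMDiff 𝓘(ℝ, E) 𝓘(ℝ, ℂ) ∞ f → (∀ g h, π g = π h → f g = f h) →
      ∀ X : E, ∀ L : ℂ →L[ℝ] ℝ, Ψ (fun g => L (lder X f g)) = 0 := by
    intro f hf hfib X L
    have hl := contMDiff_lder hπ.isLocalDiffeomorph hf X
    obtain ⟨v, hv⟩ := exists_boundedContinuousFunction hπ (u := fun g => L (lder X f g))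
      (L.continuous.comp hl.continuous)
      (fun g h hgh => congrArg L (lder_eq_of_fiber hπ hfib X g h hgh))
    rw [← hv, hΨ]
    refine mean_derivative_eq_zero hπ hφ (u := fun g => L (f g)) (X := X)
      (L.contDiff.contMDiff.comp hf) (fun g h hgh => congrArg L (hfib g h hgh)) fun g => ?_
    have hd : DifferentiableAt ℝ (fun z => f (g * expChart E G z)) (expZero E G) :=
      (hasMFDerivAt_comp_mul_expChart
        (hf.mdifferentiableAt (by simp))).mdifferentiableAt.differentiableAt
    rw [hv]
    exact (congrArg (fun T : E →L[ℝ] ℝ => T X) (L.hasFDerivAt.comp _ hd.hasFDerivAt).fderiv).symm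
  refine ⟨Φ, ?_, fun f hf => ?_, fun f hf hfib X => ?_⟩
  · have h1 : Ψ (fun _ => (1 : ℝ)) = 1 := (hΨ 1).trans hφ1
    have h2 : Ψ (fun _ => (0 : ℝ)) = 0 := map_zero Ψ
    exact Complex.ext h1 h2
  · change Ψ (fun g => (f g).im) = 0
    simp only [hf]
    exact map_zero Ψ
  · exact Complex.ext (hder f hf hfib X Complex.reCLM) (hder f hf hfib X Complex.imCLM)

end Mean
-- Continuity of alternating maps in finite dimension
section ContinuousAlternating

variable {V : Type*} [NormedAddCommGroup V] [NormedSpace ℝ V] [FiniteDimensional ℝ V]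

theorem continuous_alternatingMap {k : ℕ} (η : V [⋀^Fin k]→ₗ[ℝ] ℂ) : Continuous η := by
  induction mem_span_wedge η using Submodule.span_induction with
  | mem η h =>
    obtain ⟨α, rfl⟩ := h
    refine Continuous.matrix_det (continuous_matrix fun i j => ?_)
    exact (α j).continuous_of_finiteDimensional.comp (continuous_apply i)
  | zero => exact continuous_const
  | add x y _ _ hx hy => exact hx.add hy
  | smul c x _ hx => exact hx.const_smul c

/-- An alternating map on a finite-dimensional space, as a continuous alternating map. -/
def toContinuousAlternating {k : ℕ} (η : V [⋀^Fin k]→ₗ[ℝ] ℂ) : V [⋀^Fin k]→L[ℝ] ℂ where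
  toFun := η
  map_update_add' := η.map_update_add'
  map_update_smul' := η.map_update_smul'
  map_eq_zero_of_eq' := η.map_eq_zero_of_eq'
  cont := continuous_alternatingMap η

end ContinuousAlternating

/-! ### Forms on M as functions into forms on the Lie algebra -/

section Invariant

open Filter Topology
open scoped Manifold ContDiff

variable {E : Type*} [NormedAddCommGroup E] [NormedSpace ℝ E]
  {G : Type*} [TopologicalSpace G] [ChartedSpace E G] [Group G]
  {M : Type*} [TopologicalSpace M] [ChartedSpace E M] {π : G → M} {Γ : Subgroup G}
  {J : GroupLieAlgebra 𝓘(ℝ, E) G →ₗ[ℝ] GroupLieAlgebra 𝓘(ℝ, E) G}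
  {JM : (x : M) → TangentSpace 𝓘(ℝ, E) x →L[ℝ] TangentSpace 𝓘(ℝ, E) x}

instance finiteDimensional_groupLieAlgebra [FiniteDimensional ℝ E] :
    FiniteDimensional ℝ (GroupLieAlgebra 𝓘(ℝ, E) G) :=
  inferInstanceAs (FiniteDimensional ℝ E)

/-- The left-invariant frame, from the Lie algebra to the tangent space. -/
def frameLin (π : G → M) (g : G) :
    GroupLieAlgebra 𝓘(ℝ, E) G →ₗ[ℝ] TangentSpace 𝓘(ℝ, E) (π g) :=
  (frame (E := E) π g : E →L[ℝ] E).toLinearMap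

/-- A differential form on `M` in the left-invariant frame, on the Lie algebra. -/
def coefLie {k : ℕ} (π : G → M) (η : (x : M) → TangentSpace 𝓘(ℝ, E) x [⋀^Fin k]→L[ℝ] ℂ) (g : G) :
    GroupLieAlgebra 𝓘(ℝ, E) G [⋀^Fin k]→ₗ[ℝ] ℂ :=
  (η (π g)).toAlternatingMap.compLinearMap (frameLin π g)

theorem coefLie_eq_of_fiber (hπ : IsQuotientManifold E Γ π) {g h : G} (hgh : π g = π h) {k : ℕ}
    (η : (x : M) → TangentSpace 𝓘(ℝ, E) x [⋀^Fin k]→L[ℝ] ℂ) : coefLie π η g = coefLie π η h := by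
  ext X
  change (η (π g) : E [⋀^Fin k]→L[ℝ] ℂ) (fun i => frame (E := E) π g (X i)) =
    (η (π h) : E [⋀^Fin k]→L[ℝ] ℂ) (fun i => frame (E := E) π h (X i))
  rw [frame_eq_of_fiber hπ hgh, hgh]

variable [LieGroup 𝓘(ℝ, E) ∞ G]

theorem frame_isInvertible (hπ : IsLocalDiffeomorph 𝓘(ℝ, E) 𝓘(ℝ, E) ∞ π) (g : G) :
    (frame (E := E) π g).IsInvertible := by
  have h2 : (modelDeriv E E π g).IsInvertible :=
    ⟨hπ.mfderivToContinuousLinearEquiv (by simp) g, rfl⟩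
  have h3 : (modelDeriv E E (g * ·) (1 : G)).IsInvertible :=
    modelDeriv_mul_left_isInvertible g
  rw [frame_eq_comp hπ]
  exact h2.comp h3

theorem frameLin_bijective (hπ : IsLocalDiffeomorph 𝓘(ℝ, E) 𝓘(ℝ, E) ∞ π) (g : G) :
    Function.Bijective (frameLin (E := E) π g) := by
  obtain ⟨e, he⟩ := frame_isInvertible hπ g
  have : Function.Bijective (frame (E := E) π g) := he ▸ e.bijective
  exact this

theorem form_ext (hπ : IsQuotientManifold E Γ π) {k : ℕ}
    {η η' : (x : M) → TangentSpace 𝓘(ℝ, E) x [⋀^Fin k]→L[ℝ] ℂ}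
    (h : ∀ g, coefLie π η g = coefLie π η' g) : η = η' := by
  funext x
  obtain ⟨g, rfl⟩ := hπ.surjective x
  refine ContinuousAlternatingMap.ext fun v => ?_
  choose w hw using fun i => (frameLin_bijective hπ.isLocalDiffeomorph g).2 (v i)
  obtain rfl : (fun i => frameLin π g (w i)) = v := funext hw
  exact congrArg (fun A => A w) (h g)

theorem JM_frameLin (hπ : IsLocalDiffeomorph 𝓘(ℝ, E) 𝓘(ℝ, E) ∞ π) (hJM : IsInvariantField π J JM)
    (g : G) (X : GroupLieAlgebra 𝓘(ℝ, E) G) : JM (π g) (frameLin π g X) = frameLin π g (J X) := by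
  have h : ∀ Y : GroupLieAlgebra 𝓘(ℝ, E) G, frameLin π g Y =
      mfderiv 𝓘(ℝ, E) 𝓘(ℝ, E) π g (mulInvariantVectorField Y g) := fun Y =>
    frame_apply (hπ.mdifferentiable (by simp) g) Y
  rw [h, h]
  exact hJM g X

theorem JM_sq (hπ : IsQuotientManifold E Γ π) (hJM : IsInvariantField π J JM)
    (hJ : ∀ X, J (J X) = -X) (x : M) (v : TangentSpace 𝓘(ℝ, E) x) :
    (JM x).toLinearMap ((JM x).toLinearMap v) = -v := by
  obtain ⟨g, rfl⟩ := hπ.surjective x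
  obtain ⟨X, rfl⟩ := (frameLin_bijective hπ.isLocalDiffeomorph g).2 v
  change JM (π g) (JM (π g) (frameLin π g X)) = _
  rw [JM_frameLin hπ.isLocalDiffeomorph hJM, JM_frameLin hπ.isLocalDiffeomorph hJM, hJ, map_neg]

theorem coefLie_typePart (hπ : IsLocalDiffeomorph 𝓘(ℝ, E) 𝓘(ℝ, E) ∞ π)
    (hJM : IsInvariantField π J JM) (p q : ℤ) {k : ℕ}
    (η : (x : M) → TangentSpace 𝓘(ℝ, E) x [⋀^Fin k]→L[ℝ] ℂ) (g : G) :
    coefLie π (typePart JM p q η) g = typeComponent J p q (coefLie π η g) := by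
  unfold coefLie
  rw [typePart_toAlternatingMap]
  exact (typeComponent_compLinearMap (JM_frameLin hπ hJM g) p q _).symm

/-- Being of type (p, q) is being fixed by the type projection, an equation that can be tested in
the frame. -/
theorem typeSpace_iff_coefLie [FiniteDimensional ℝ E] (hπ : IsQuotientManifold E Γ π)
    (hJM : IsInvariantField π J JM) (hJ : ∀ X, J (J X) = -X) (p q : ℤ) {k : ℕ}
    (η : (x : M) → TangentSpace 𝓘(ℝ, E) x [⋀^Fin k]→L[ℝ] ℂ) :
    (∀ x, (η x).toAlternatingMap ∈ typeSpace (JM x).toLinearMap k p q) ↔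
      ∀ g, coefLie π η g ∈ typeSpace J k p q := by
  have hfin : ∀ x : M, FiniteDimensional ℝ (TangentSpace 𝓘(ℝ, E) x) := fun x =>
    inferInstanceAs (FiniteDimensional ℝ E)
  have h1 : (∀ x, (η x).toAlternatingMap ∈ typeSpace (JM x).toLinearMap k p q) ↔
      typePart JM p q η = η := by
    rw [funext_iff]
    refine forall_congr' fun x => ?_
    rw [mem_typeSpace_iff (JM_sq hπ hJM hJ x), ← typePart_toAlternatingMap]
    exact ContinuousAlternatingMap.toAlternatingMap_injective.eq_iff
  simp only [h1, mem_typeSpace_iff hJ, ← coefLie_typePart hπ.isLocalDiffeomorph hJM]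
  exact ⟨fun h g => by rw [h], form_ext hπ⟩

end Invariant
-- Averaging and inclusion of invariant forms
section Average

open Filter Topology
open scoped Manifold ContDiff

variable {E : Type*} [NormedAddCommGroup E] [NormedSpace ℝ E] [FiniteDimensional ℝ E]
  [CompleteSpace E]
  {G : Type*} [TopologicalSpace G] [ChartedSpace E G] [Group G] [LieGroup 𝓘(ℝ, E) ∞ G]
  {M : Type*} [TopologicalSpace M] [ChartedSpace E M] {π : G → M} {Γ : Subgroup G}
  {J : GroupLieAlgebra 𝓘(ℝ, E) G →ₗ[ℝ] GroupLieAlgebra 𝓘(ℝ, E) G}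
  {JM : (x : M) → TangentSpace 𝓘(ℝ, E) x →L[ℝ] TangentSpace 𝓘(ℝ, E) x}
  {Φ : (G → ℂ) →ₗ[ℂ] ℂ}

/-- The average of a differential form on `M`, a form on the Lie algebra. -/
def avg (Φ : (G → ℂ) →ₗ[ℂ] ℂ) (π : G → M) :
    MForm E M →ₗ[ℂ] LieForm (GroupLieAlgebra 𝓘(ℝ, E) G) where
  toFun η := fun k => averageAlternating Φ fun g => coefLie π (η k) g
  map_add' η η' := by
    funext k
    ext X
    exact map_add Φ (fun g => coefLie π (η k) g X) fun g => coefLie π (η' k) g X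
  map_smul' c η := by
    funext k
    ext X
    exact map_smul Φ c fun g => coefLie π (η k) g X

omit [FiniteDimensional ℝ E] in
theorem avg_apply (η : MForm E M) (k : ℕ) (X : Fin k → GroupLieAlgebra 𝓘(ℝ, E) G) :
    avg Φ π η k X = Φ fun g => coefLie π (η k) g X := rfl

/-- The invariant differential form on `M` given by a form on the Lie algebra. -/
def incl (π : G → M) (hs : Function.Surjective π) :
    LieForm (GroupLieAlgebra 𝓘(ℝ, E) G) →ₗ[ℂ] MForm E M where
  toFun α := fun k x => ContinuousAlternatingMap.compContinuousLinearMap (M := E) (M' := E)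
    (toContinuousAlternating (V := E) (α k))
    (frame (E := E) π (Function.surjInv hs x)).inverse
  map_add' _ _ := rfl
  map_smul' _ _ := rfl

/-- `incl` inverts the frame at a chosen preimage of each point; since the frame depends only on the
fibre, the choice does not matter. -/
theorem coefLie_incl (hπ : IsQuotientManifold E Γ π)
    (α : LieForm (GroupLieAlgebra 𝓘(ℝ, E) G)) (k : ℕ) (g : G) :
    coefLie π (incl π hπ.surjective α k) g = α k := by
  rw [← coefLie_eq_of_fiber hπ (Function.surjInv_eq hπ.surjective (π g))]
  set h := Function.surjInv hπ.surjective (π g) with hh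
  have hπh : π h = π g := Function.surjInv_eq hπ.surjective (π g)
  ext X
  change (α k) (fun i => (frame (E := E) π (Function.surjInv hπ.surjective (π h))).inverse
    (frame (E := E) π h (X i))) = α k X
  rw [hπh, ← hh]
  congr 1
  funext i
  obtain ⟨e, he⟩ := frame_isInvertible hπ.isLocalDiffeomorph h
  rw [← he, ContinuousLinearMap.inverse_equiv]
  exact e.symm_apply_apply (X i)

theorem avg_incl (hπ : IsQuotientManifold E Γ π) (hΦ : Φ (fun _ => 1) = 1)
    (α : LieForm (GroupLieAlgebra 𝓘(ℝ, E) G)) : avg Φ π (incl π hπ.surjective α) = α := by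
  funext k
  ext X
  rw [avg_apply]
  simp only [coefLie_incl hπ]
  have : (fun _ : G => α k X) = α k X • fun _ => (1 : ℂ) := by
    funext g
    simp
  rw [this, map_smul, hΦ, smul_eq_mul, mul_one]

omit [FiniteDimensional ℝ E] in
theorem avg_typePart (hπ : IsLocalDiffeomorph 𝓘(ℝ, E) 𝓘(ℝ, E) ∞ π)
    (hJM : IsInvariantField π J JM) (p q : ℤ) (η : MForm E M) :
    avg Φ π (fun k => typePart JM p q (η k)) = fun k => typeComponent J p q (avg Φ π η k) := by
  funext k
  refine Eq.trans ?_ (typeComponent_averageAlternating Φ J p q _).symm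
  exact congrArg (averageAlternating Φ) (funext fun g => coefLie_typePart hπ hJM p q (η k) g)

theorem incl_typeComponent (hπ : IsQuotientManifold E Γ π)
    (hJM : IsInvariantField π J JM) (p q : ℤ) (α : LieForm (GroupLieAlgebra 𝓘(ℝ, E) G)) :
    incl π hπ.surjective (fun k => typeComponent J p q (α k)) =
      fun k => typePart JM p q (incl π hπ.surjective α k) := by
  funext k
  refine form_ext hπ fun g => ?_
  rw [coefLie_typePart hπ.isLocalDiffeomorph hJM, coefLie_incl hπ, coefLie_incl hπ]

variable [IsManifold 𝓘(ℝ, E) ∞ M]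

omit [FiniteDimensional ℝ E] [CompleteSpace E] in
theorem mean_coef_extD_zero (hπ : IsLocalDiffeomorph 𝓘(ℝ, E) 𝓘(ℝ, E) ∞ π)
    {η : (x : M) → TangentSpace 𝓘(ℝ, E) x [⋀^Fin 0]→L[ℝ] ℂ} (hη : IsSmoothForm η)
    (hΦ : ∀ X : E, ∀ Y, Φ (lder X fun h => coef π η h Y) = 0) (X : Fin 1 → E) :
    Φ (fun g => coef π (extD η) g X) = 0 := by
  simp only [coef_extD_zero hπ hη]
  exact hΦ (X 0) ![]

omit [FiniteDimensional ℝ E] in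
theorem mean_coef_extD_succ (hπ : IsLocalDiffeomorph 𝓘(ℝ, E) 𝓘(ℝ, E) ∞ π) {m : ℕ}
    {η : (x : M) → TangentSpace 𝓘(ℝ, E) x [⋀^Fin (m + 1)]→L[ℝ] ℂ} (hη : IsSmoothForm η)
    (hΦ : ∀ X : E, ∀ Y, Φ (lder X fun h => coef π η h Y) = 0) (X : Fin (m + 2) → E) :
    Φ (fun g => coef π (extD η) g X) =
      ∑ i : Fin (m + 1), ∑ j ≥ i, (-1 : ℂ) ^ ((i : ℕ) + ((j : ℕ) + 1)) *
        Φ fun g => coef π η g (Matrix.vecCons (modelBracket G (X i.castSucc) (X j.succ))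
          (j.removeNth <| i.castSucc.removeNth X)) := by
  have : (fun g => coef π (extD η) g X) =
      (∑ i : Fin (m + 2), (-1 : ℂ) ^ (i : ℕ) •
        lder (X i) (fun h => coef π η h (i.removeNth X))) +
        ∑ i : Fin (m + 1), ∑ j ≥ i, (-1 : ℂ) ^ ((i : ℕ) + ((j : ℕ) + 1)) •
          fun g => coef π η g (Matrix.vecCons (modelBracket G (X i.castSucc) (X j.succ))
            (j.removeNth <| i.castSucc.removeNth X)) := by
    funext g
    rw [coef_extD_succ hπ hη]
    simp only [Pi.add_apply, Finset.sum_apply, Pi.smul_apply, smul_eq_mul]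
  rw [this, map_add, map_sum, map_sum]
  simp only [map_smul, hΦ, mul_zero, Finset.sum_const_zero, zero_add, map_sum, smul_eq_mul]

omit [FiniteDimensional ℝ E] in
theorem avg_mD (hπ : IsQuotientManifold E Γ π)
    (hΦ : ∀ f, ContMDiff 𝓘(ℝ, E) 𝓘(ℝ, ℂ) ∞ f → (∀ g h, π g = π h → f g = f h) →
      ∀ X : E, Φ (lder X f) = 0) {η : MForm E M} (hη : ∀ k, IsSmoothForm (η k)) :
    avg Φ π (mD η) = ceD (avg Φ π η) := by
  have hlder : ∀ (k : ℕ) (X : E) (Y : Fin k → E),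
      Φ (lder X fun h => coef π (η k) h Y) = 0 := fun k X Y =>
    hΦ _ ((hη k).contMDiff_coef hπ.isLocalDiffeomorph Y) (fun g h hgh =>
      congrArg (fun A => A Y) (coefLie_eq_of_fiber hπ hgh (η k))) X
  funext k
  match k with
  | 0 => exact AlternatingMap.ext fun X => map_zero Φ
  | 1 =>
    exact AlternatingMap.ext fun X =>
      mean_coef_extD_zero hπ.isLocalDiffeomorph (hη 0) (hlder 0) X
  | m + 2 =>
    exact AlternatingMap.ext fun X =>
      (mean_coef_extD_succ hπ.isLocalDiffeomorph (hη (m + 1)) (hlder (m + 1)) X).trans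
        (ceDiff_apply (avg Φ π η (m + 1)) X).symm

theorem isSmoothForm_incl (hπ : IsQuotientManifold E Γ π)
    (α : LieForm (GroupLieAlgebra 𝓘(ℝ, E) G)) (k : ℕ) :
    IsSmoothForm (incl π hπ.surjective α k) := by
  refine isSmoothForm_of_coef hπ.isLocalDiffeomorph hπ.surjective fun X => ?_
  have : (fun g => coef π (incl π hπ.surjective α k) g X) = fun _ => α k X :=
    funext fun g => congrArg (fun A => A X) (coefLie_incl hπ α k g)
  rw [this]
  exact contMDiff_const

/-- Constant coefficients have zero derivative, so only the bracket terms of d remain. -/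
theorem mD_incl (hπ : IsQuotientManifold E Γ π) (α : LieForm (GroupLieAlgebra 𝓘(ℝ, E) G)) :
    mD (incl π hπ.surjective α) = incl π hπ.surjective (ceD α) := by
  have hcoef : ∀ (k : ℕ) (g : G) (Y : Fin k → E),
      coef π (incl π hπ.surjective α k) g Y = α k Y := fun k g Y =>
    congrArg (fun A => A Y) (coefLie_incl hπ α k g)
  have hlder : ∀ (X : E) (c : ℂ) (g : G), lder X (fun _ => c) g = 0 := fun X c g => by
    simp [lder]
  have hs := isSmoothForm_incl hπ α
  funext k
  match k with
  | 0 =>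
    refine form_ext hπ fun g => ?_
    rw [coefLie_incl hπ]
    rfl
  | 1 =>
    refine form_ext hπ fun g => ?_
    rw [coefLie_incl hπ]
    ext X
    refine (coef_extD_zero hπ.isLocalDiffeomorph (hs 0) g X).trans ?_
    simp only [hcoef]
    exact hlder _ _ _
  | m + 2 =>
    refine form_ext hπ fun g => ?_
    rw [coefLie_incl hπ]
    refine AlternatingMap.ext fun (X : Fin (m + 2) → E) => ?_
    refine Eq.trans ?_ (ceDiff_apply (α (m + 1)) X).symm
    refine (coef_extD_succ hπ.isLocalDiffeomorph (hs (m + 1)) g X).trans ?_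
    simp only [hcoef, hlder, mul_zero, Finset.sum_const_zero, zero_add]
    rfl

theorem isSmoothForm_extD (hπ : IsQuotientManifold E Γ π) {k : ℕ}
    {η : (x : M) → TangentSpace 𝓘(ℝ, E) x [⋀^Fin k]→L[ℝ] ℂ} (hη : IsSmoothForm η) :
    IsSmoothForm (extD η) := by
  have h := hπ.isLocalDiffeomorph
  have hl : ∀ (X : E) (Y : Fin k → E), ContMDiff 𝓘(ℝ, E) 𝓘(ℝ, ℂ) ∞
      (lder X fun g => coef π η g Y) := fun X Y => contMDiff_lder h (hη.contMDiff_coef h Y) X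
  have hmul : ∀ (c : ℂ) (f : G → ℂ), ContMDiff 𝓘(ℝ, E) 𝓘(ℝ, ℂ) ∞ f →
      ContMDiff 𝓘(ℝ, E) 𝓘(ℝ, ℂ) ∞ fun g => c * f g := fun c f hf =>
    (contDiff_const.mul contDiff_id).contMDiff.comp hf
  refine isSmoothForm_of_coef h hπ.surjective fun X => ?_
  match k with
  | 0 =>
    simp only [coef_extD_zero h hη]
    exact hl _ _
  | m + 1 =>
    simp only [coef_extD_succ h hη]
    refine ContMDiff.add (contMDiff_finsetSum fun i _ => hmul _ _ (hl _ _))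
      (contMDiff_finsetSum fun i _ => contMDiff_finsetSum fun j _ =>
        hmul _ _ (hη.contMDiff_coef h _))

omit [CompleteSpace E] in
theorem isSmoothForm_typePart (hπ : IsQuotientManifold E Γ π) (hJM : IsInvariantField π J JM)
    (p q : ℤ) {k : ℕ} {η : (x : M) → TangentSpace 𝓘(ℝ, E) x [⋀^Fin k]→L[ℝ] ℂ}
    (hη : IsSmoothForm η) : IsSmoothForm (typePart JM p q η) := by
  have h := hπ.isLocalDiffeomorph
  refine isSmoothForm_of_coef h hπ.surjective fun (X : Fin k → GroupLieAlgebra 𝓘(ℝ, E) G) => ?_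
  have hmul : ∀ (c : ℂ) (f : G → ℂ), ContMDiff 𝓘(ℝ, E) 𝓘(ℝ, ℂ) ∞ f →
      ContMDiff 𝓘(ℝ, E) 𝓘(ℝ, ℂ) ∞ fun g => c * f g := fun c f hf =>
    (contDiff_const.mul contDiff_id).contMDiff.comp hf
  have h1 : (fun g => coef π (typePart JM p q η) g X) =
      fun g => typeComponent J p q (coefLie π η g) (X : Fin k → GroupLieAlgebra 𝓘(ℝ, E) G) :=
    funext fun g => congrArg (fun A => A X) (coefLie_typePart h hJM p q η g)
  rw [h1]
  unfold typeComponent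
  split_ifs
  · simp only [alternating_sum_apply]
    exact contMDiff_finsetSum fun j _ => hmul _ _ (hη.contMDiff_coef h _)
  · exact contMDiff_const

end Average
-- A common form of ∂ and ∂̄ on M
section Operators

open scoped Manifold ContDiff

variable {E : Type*} [NormedAddCommGroup E] [NormedSpace ℝ E]
  {M : Type*} [TopologicalSpace M] [ChartedSpace E M]
  {JM : (x : M) → TangentSpace 𝓘(ℝ, E) x →L[ℝ] TangentSpace 𝓘(ℝ, E) x} {p q : ℤ}

/-- The component of type `(p, q)` of the differential. -/
def typeD (JM : (x : M) → TangentSpace 𝓘(ℝ, E) x →L[ℝ] TangentSpace 𝓘(ℝ, E) x) (p q : ℤ)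
    (η : MForm E M) : MForm E M := fun k => typePart JM p q (mD η k)

theorem typeD_add {η η' : MForm E M} (h : ∀ k, IsSmoothForm (η k)) (h' : ∀ k, IsSmoothForm (η' k)) :
    typeD JM p q (η + η') = typeD JM p q η + typeD JM p q η' := by
  funext k x
  exact (congrArg (fun ζ : MForm E M => typePart JM p q (ζ k) x) (mD_add h h')).trans
    (typePart_add JM p q _ _ x)

theorem typeD_smul (c : ℂ) {η : MForm E M} (h : ∀ k, IsSmoothForm (η k)) :
    typeD JM p q (c • η) = c • typeD JM p q η := by
  funext k x
  exact (congrArg (fun ζ : MForm E M => typePart JM p q (ζ k) x) (mD_smul c h)).trans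
    (typePart_smul JM p q c _ x)

theorem mem_mZ_iff {η : MForm E M} :
    η ∈ mZ JM p q ↔ η ∈ mA JM p q ∧ mDelbar JM p q η = 0 := by
  constructor
  · rintro ⟨η, hη, rfl⟩
    exact ⟨η.2, hη⟩
  · rintro ⟨h1, h2⟩
    exact ⟨⟨η, h1⟩, h2, rfl⟩

end Operators

/-! ### Comparison of M with the Lie algebra -/

section Comparison

open scoped Manifold ContDiff

variable {E : Type*} [NormedAddCommGroup E] [NormedSpace ℝ E] [FiniteDimensional ℝ E]
  [CompleteSpace E]
  {G : Type*} [TopologicalSpace G] [ChartedSpace E G] [Group G] [LieGroup 𝓘(ℝ, E) ∞ G]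
  {M : Type*} [TopologicalSpace M] [ChartedSpace E M] {π : G → M} {Γ : Subgroup G}
  {J : GroupLieAlgebra 𝓘(ℝ, E) G →ₗ[ℝ] GroupLieAlgebra 𝓘(ℝ, E) G}
  {JM : (x : M) → TangentSpace 𝓘(ℝ, E) x →L[ℝ] TangentSpace 𝓘(ℝ, E) x}
  {Φ : (G → ℂ) →ₗ[ℂ] ℂ} {p q : ℤ}

omit [CompleteSpace E] in
theorem typeD_eq_zero_of_lt (hπ : IsQuotientManifold E Γ π) (hJM : IsInvariantField π J JM)
    (hJ : ∀ X, J (J X) = -X) (hq : (Module.finrank ℝ E : ℤ) < 2 * q) (η : MForm E M) :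
    typeD JM p q η = 0 := by
  funext k
  refine form_ext hπ fun g => ?_
  refine (coefLie_typePart hπ.isLocalDiffeomorph hJM p q (mD η k) g).trans ?_
  have h := typeComponent_mem hJ p q (coefLie π (mD η k) g)
  rw [typeSpace_eq_bot_of_lt J hq, Submodule.mem_bot] at h
  exact h

theorem avg_mem_lieA (hπ : IsQuotientManifold E Γ π) (hJM : IsInvariantField π J JM)
    (hJ : ∀ X, J (J X) = -X) {η : MForm E M} (hη : η ∈ mA JM p q) : avg Φ π η ∈ lieA J p q := by
  intro k
  have h := (typeSpace_iff_coefLie hπ hJM hJ p q (η k)).1 (hη k).2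
  rw [mem_typeSpace_iff hJ]
  refine (typeComponent_averageAlternating Φ J p q _).trans ?_
  exact congrArg (averageAlternating Φ) (funext fun g => typeComponent_of_mem (h g))

variable [IsManifold 𝓘(ℝ, E) ∞ M]

theorem isSmoothForm_typeD (hπ : IsQuotientManifold E Γ π) (hJM : IsInvariantField π J JM)
    {η : MForm E M} (hη : ∀ k, IsSmoothForm (η k)) (k : ℕ) : IsSmoothForm (typeD JM p q η k) := by
  refine isSmoothForm_typePart hπ hJM p q ?_
  match k with
  | 0 => exact IsSmoothForm.zero
  | k + 1 => exact isSmoothForm_extD hπ (hη k)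

theorem incl_mem_mA (hπ : IsQuotientManifold E Γ π) (hJM : IsInvariantField π J JM)
    (hJ : ∀ X, J (J X) = -X) {α : LieForm (GroupLieAlgebra 𝓘(ℝ, E) G)} (hα : α ∈ lieA J p q) :
    incl π hπ.surjective α ∈ mA JM p q := fun k =>
  ⟨isSmoothForm_incl hπ α k, (typeSpace_iff_coefLie hπ hJM hJ p q _).2 fun g => by
    rw [coefLie_incl hπ]
    exact hα k⟩

theorem avg_typeD (hπ : IsQuotientManifold E Γ π) (hJM : IsInvariantField π J JM)
    (hΦ : ∀ f, ContMDiff 𝓘(ℝ, E) 𝓘(ℝ, ℂ) ∞ f → (∀ g h, π g = π h → f g = f h) →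
      ∀ X : E, Φ (lder X f) = 0) {η : MForm E M} (hη : ∀ k, IsSmoothForm (η k)) :
    avg Φ π (typeD JM p q η) = fun k => typeComponent J p q (ceD (avg Φ π η) k) := by
  rw [← avg_mD hπ hΦ hη]
  exact avg_typePart hπ.isLocalDiffeomorph hJM p q (mD η)

theorem typeD_incl (hπ : IsQuotientManifold E Γ π) (hJM : IsInvariantField π J JM)
    (α : LieForm (GroupLieAlgebra 𝓘(ℝ, E) G)) : typeD JM p q (incl π hπ.surjective α) =
      incl π hπ.surjective fun k => typeComponent J p q (ceD α k) := by
  rw [incl_typeComponent hπ hJM, ← mD_incl hπ]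
  rfl

/-- If the Dolbeault cohomologies are isomorphic, a closed form with zero average is exact. -/
theorem exists_mDelbar_eq (hπ : IsQuotientManifold E Γ π) (hJM : IsInvariantField π J JM)
    (hJ : ∀ X, J (J X) = -X) (hΦ1 : Φ (fun _ => 1) = 1)
    (hΦ : ∀ f, ContMDiff 𝓘(ℝ, E) 𝓘(ℝ, ℂ) ∞ f → (∀ g h, π g = π h → f g = f h) →
      ∀ X : E, Φ (lder X f) = 0) (e : Dolbeault JM p q ≃ₗ[ℂ] LieDolbeault J p q)
    {ζ : MForm E M} (hζ : ζ ∈ mZ JM p q) (hζ0 : avg Φ π ζ = 0) :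
    ∃ ψ ∈ mA JM p (q - 1), mDelbar JM p (q - 1) ψ = ζ := by
  have hZ : ∀ η ∈ mZ JM p q, avg Φ π η ∈ lieZ J p q := fun η hη => by
    obtain ⟨h1, h2⟩ := mem_mZ_iff.1 hη
    refine mem_lieZ_iff.2 ⟨avg_mem_lieA hπ hJM hJ h1, ?_⟩
    refine (avg_typeD (p := p) (q := q + 1) hπ hJM hΦ fun k => (h1 k).1).symm.trans ?_
    exact (congrArg (avg Φ π) h2).trans (map_zero _)
  have hB : (LinearMap.range (mDelbarLin JM p (q - 1))).submoduleOf (mZ JM p q) ≤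
      ((LinearMap.range (lieDelbarLin J p (q - 1))).submoduleOf (lieZ J p q)).comap
        ((avg Φ π).restrict hZ) := by
    rintro ⟨η, hη⟩ ⟨ψ, hψ⟩
    refine ⟨⟨avg Φ π ψ, avg_mem_lieA hπ hJM hJ ψ.2⟩, ?_⟩
    refine (avg_typeD (p := p) (q := q - 1 + 1) hπ hJM hΦ fun k => (ψ.2 k).1).symm.trans ?_
    exact congrArg (avg Φ π) hψ
  -- The map induced by averaging on cohomology; `incl` provides preimages.
  let S : Dolbeault JM p q →ₗ[ℂ] LieDolbeault J p q :=
    Submodule.mapQ _ _ ((avg Φ π).restrict hZ) hB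
  have hS : Function.Surjective S := by
    intro c
    obtain ⟨⟨α, hα⟩, rfl⟩ := Submodule.Quotient.mk_surjective _ c
    obtain ⟨h1, h2⟩ := mem_lieZ_iff.1 hα
    have h3 : incl π hπ.surjective α ∈ mZ JM p q := by
      refine mem_mZ_iff.2 ⟨incl_mem_mA hπ hJM hJ h1, ?_⟩
      refine (typeD_incl (p := p) (q := q + 1) hπ hJM α).trans ?_
      exact (congrArg (incl π hπ.surjective) h2).trans (map_zero _)
    refine ⟨Submodule.Quotient.mk ⟨_, h3⟩, ?_⟩
    exact congrArg Submodule.Quotient.mk (Subtype.ext (avg_incl hπ hΦ1 α))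
  have := finite_lieDolbeault (J := J) (p := p) (q := q)
  -- A surjective endomorphism of a finite-dimensional space is injective. So any abstract
  -- isomorphism e suffices; it need not be induced by averaging or inclusion.
  have hinj : Function.Injective (S ∘ₗ e.symm.toLinearMap) :=
    LinearMap.injective_iff_surjective.2 (hS.comp e.symm.surjective)
  have hker : (Submodule.Quotient.mk ⟨ζ, hζ⟩ : Dolbeault JM p q) = 0 := by
    apply e.injective
    apply hinj
    rw [map_zero, map_zero, LinearMap.comp_apply, LinearEquiv.coe_coe, e.symm_apply_apply]
    have h0 : (avg Φ π).restrict hZ ⟨ζ, hζ⟩ = 0 := Subtype.ext hζ0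
    refine (Submodule.mapQ_apply _ _ _ _).trans ?_
    rw [h0]
    exact Submodule.Quotient.mk_zero _
  rw [Submodule.Quotient.mk_eq_zero] at hker
  obtain ⟨ψ, hψ⟩ := hker
  exact ⟨ψ, ψ.2, hψ⟩

omit [FiniteDimensional ℝ E] [IsManifold 𝓘(ℝ, E) ∞ M] in
theorem avg_real (hΦ : ∀ f, (∀ g, (f g).im = 0) → (Φ f).im = 0) {φ : MForm E M}
    (hφ : ∀ k x X, (φ k x X).im = 0) (k : ℕ) (X : Fin k → GroupLieAlgebra 𝓘(ℝ, E) G) :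
    (avg Φ π φ k X).im = 0 := hΦ _ fun _ => hφ k _ _

/-- Invariant data are solved on M and the solution is averaged; the average of the invariant
left-hand side is itself. -/
theorem lieWeakDdbar_of_mWeakDdbar [CompactSpace M] [Group.IsNilpotent G]
    (hπ : IsQuotientManifold E Γ π) (hJM : IsInvariantField π J JM) (hJ : ∀ X, J (J X) = -X) {n : ℤ}
    (h : MWeakDdbar JM n) : LieWeakDdbar J n := by
  obtain ⟨Φ, hΦ1, -, hΦ⟩ := exists_mean hπ
  rintro φ hφ hreal ⟨η, hη, hηφ⟩
  obtain ⟨ψ, hψ, hψφ⟩ := h (incl π hπ.surjective φ) (incl_mem_mA hπ hJM hJ hφ)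
    (fun k x X => hreal k _) ⟨incl π hπ.surjective η, incl_mem_mA hπ hJM hJ hη,
      (typeD_incl hπ hJM φ).trans ((congrArg (incl π hπ.surjective) hηφ).trans
        (typeD_incl hπ hJM η).symm)⟩
  have hs : ∀ k, IsSmoothForm (ψ k) := fun k => (hψ k).1
  refine ⟨avg Φ π ψ, avg_mem_lieA hπ hJM hJ hψ, ?_⟩
  have h1 : avg Φ π (mDelbar JM (n - 1) (n - 1) (incl π hπ.surjective φ)) =
      lieDelbar J (n - 1) (n - 1) φ := by
    refine (congrArg (avg Φ π) (typeD_incl hπ hJM φ)).trans ?_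
    exact avg_incl hπ hΦ1 _
  have h2 : avg Φ π (mDelbar JM (n - 2) (n - 1) ψ) = lieDelbar J (n - 2) (n - 1) (avg Φ π ψ) :=
    avg_typeD hπ hJM hΦ hs
  have h3 : avg Φ π (mDel JM (n - 2) n (mDelbar JM (n - 2) (n - 1) ψ)) =
      lieDel J (n - 2) n (avg Φ π (mDelbar JM (n - 2) (n - 1) ψ)) :=
    avg_typeD hπ hJM hΦ (isSmoothForm_typeD hπ hJM hs)
  rw [← h1, hψφ, map_smul, h3, h2]

/-- Up to a ∂̄-exact form ∂̄ψ₁, the form η is its own average. The exact part contributes ∂∂̄ψ₁ to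
∂η, and the average is handled on the Lie algebra. -/
theorem mWeakDdbar_of_lieWeakDdbar [CompactSpace M] [Group.IsNilpotent G]
    (hπ : IsQuotientManifold E Γ π) (hJM : IsInvariantField π J JM) (hJ : ∀ X, J (J X) = -X) {n : ℤ}
    (hn : Module.finrank ℝ E = 2 * n) (h : LieWeakDdbar J n)
    (e : Dolbeault JM (n - 2) n ≃ₗ[ℂ] LieDolbeault J (n - 2) n) : MWeakDdbar JM n := by
  obtain ⟨Φ, hΦ1, hΦr, hΦ⟩ := exists_mean hπ
  rintro φ hφ hreal ⟨η, hη, hηφ⟩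
  let ι : LieForm (GroupLieAlgebra 𝓘(ℝ, E) G) →ₗ[ℂ] MForm E M := incl π hπ.surjective
  have hζA : η - ι (avg Φ π η) ∈ mA JM (n - 2) n :=
    Submodule.sub_mem _ hη (incl_mem_mA hπ hJM hJ (avg_mem_lieA hπ hJM hJ hη))
  have hζ : η - ι (avg Φ π η) ∈ mZ JM (n - 2) n :=
    -- Closedness is automatic: ∂̄ lands in type (n - 2, n + 1), and 2(n + 1) exceeds the real
    -- dimension.
    mem_mZ_iff.2 ⟨hζA, typeD_eq_zero_of_lt hπ hJM hJ (by omega) _⟩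
  obtain ⟨ψ₁, hψ₁, hψ₁ζ⟩ := exists_mDelbar_eq hπ hJM hJ hΦ1 hΦ e hζ (by
    rw [map_sub, avg_incl hπ hΦ1, sub_self])
  have hη' : ι (avg Φ π η) + mDelbar JM (n - 2) (n - 1) ψ₁ = η := by rw [hψ₁ζ, add_sub_cancel]
  have hlie : lieDelbar J (n - 1) (n - 1) (avg Φ π φ) = lieDel J (n - 2) n (avg Φ π η) := by
    refine (avg_typeD hπ hJM hΦ fun k => (hφ k).1).symm.trans ?_
    exact (congrArg (avg Φ π) hηφ).trans (avg_typeD hπ hJM hΦ fun k => (hη k).1)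
  obtain ⟨ψ₀, hψ₀, hψ₀φ⟩ := h (avg Φ π φ) (avg_mem_lieA hπ hJM hJ hφ) (avg_real hΦr hreal)
    ⟨avg Φ π η, avg_mem_lieA hπ hJM hJ hη, hlie⟩
  have hψ₀A : ι ψ₀ ∈ mA JM (n - 2) (n - 1) := incl_mem_mA hπ hJM hJ hψ₀
  have hs₀ : ∀ k, IsSmoothForm (ι ψ₀ k) := isSmoothForm_incl hπ ψ₀
  have hs₁ : ∀ k, IsSmoothForm (ψ₁ k) := fun k => (hψ₁ k).1
  have hs₁' : ∀ k, IsSmoothForm ((-Complex.I • ψ₁) k) := fun k => (hs₁ k).smul _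
  have hsd : ∀ {ψ : MForm E M}, (∀ k, IsSmoothForm (ψ k)) →
      ∀ k, IsSmoothForm (typeD JM (n - 2) (n - 1 + 1) ψ k) := fun h => isSmoothForm_typeD hπ hJM h
  have hsd₁ : ∀ k, IsSmoothForm ((-Complex.I • typeD JM (n - 2) (n - 1 + 1) ψ₁) k) := fun k =>
    (hsd hs₁ k).smul _
  -- The factor -i cancels the i of the lemma: i∂∂̄(-iψ₁) = ∂∂̄ψ₁.
  refine ⟨ι ψ₀ + -Complex.I • ψ₁, Submodule.add_mem _ hψ₀A (Submodule.smul_mem _ _ hψ₁), ?_⟩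
  have h1 : mDelbar JM (n - 1) (n - 1) φ = typeD JM (n - 2 + 1) n (ι (avg Φ π η)) +
      typeD JM (n - 2 + 1) n (typeD JM (n - 2) (n - 1 + 1) ψ₁) := by
    refine hηφ.trans ?_
    rw [← typeD_add (isSmoothForm_incl hπ _) (hsd hs₁)]
    exact (congrArg (typeD JM (n - 2 + 1) n) hη').symm
  have h2 : typeD JM (n - 2 + 1) n (ι (avg Φ π η)) =
      Complex.I • typeD JM (n - 2 + 1) n (typeD JM (n - 2) (n - 1 + 1) (ι ψ₀)) := by
    rw [typeD_incl hπ hJM, typeD_incl hπ hJM, typeD_incl hπ hJM, ← map_smul]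
    exact congrArg ι (hlie.symm.trans hψ₀φ)
  rw [h1, h2]
  change _ = Complex.I • typeD JM (n - 2 + 1) n
    (typeD JM (n - 2) (n - 1 + 1) (ι ψ₀ + -Complex.I • ψ₁))
  rw [typeD_add hs₀ hs₁', typeD_smul _ hs₁, typeD_add (hsd hs₀) hsd₁,
    typeD_smul _ (hsd hs₁), smul_add, smul_smul, mul_neg, Complex.I_mul_I, neg_neg, one_smul]

end Comparison
end WeakDdbar

open scoped Manifold ContDiff in
theorem mainTheorem7 (n : ℕ)
    {G : Type*} [TopologicalSpace G] [T2Space G] [SecondCountableTopology G]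
    [ChartedSpace (EuclideanSpace ℝ (Fin (2 * n))) G]
    [Group G] [LieGroup (𝓡 (2 * n)) ∞ G] [SimplyConnectedSpace G] [Group.IsNilpotent G]
    (Γ : Subgroup G) [DiscreteTopology Γ]
    {M : Type*} [TopologicalSpace M] [T2Space M] [CompactSpace M]
    [ChartedSpace (EuclideanSpace ℝ (Fin (2 * n))) M] [IsManifold (𝓡 (2 * n)) ∞ M]
    (π : G → M) (hπ : WeakDdbar.IsQuotientManifold (EuclideanSpace ℝ (Fin (2 * n))) Γ π)
    (J : GroupLieAlgebra (𝓡 (2 * n)) G →ₗ[ℝ] GroupLieAlgebra (𝓡 (2 * n)) G)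
    (hJ : WeakDdbar.IsComplexStructure J)
    (JM : (x : M) → TangentSpace (𝓡 (2 * n)) x →L[ℝ] TangentSpace (𝓡 (2 * n)) x)
    (hJM : WeakDdbar.IsInvariantField π J JM) :
    (¬ WeakDdbar.LieWeakDdbar J n → ¬ WeakDdbar.MWeakDdbar JM n) ∧
    (WeakDdbar.LieWeakDdbar J n →
      Nonempty (WeakDdbar.Dolbeault JM (n - 2) n ≃ₗ[ℂ] WeakDdbar.LieDolbeault J (n - 2) n) →
      WeakDdbar.MWeakDdbar JM n) := by
  refine ⟨mt (WeakDdbar.lieWeakDdbar_of_mWeakDdbar hπ hJM hJ.1), fun h ⟨e⟩ =>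
    WeakDdbar.mWeakDdbar_of_lieWeakDdbar hπ hJM hJ.1 ?_ h e⟩
  rw [finrank_euclideanSpace, Fintype.card_fin]
  push_cast
  ring
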